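/- Let $r\ge 0$, let $D^r\subset\mathbb{R}^r$ be the closed unit ball with boundary sphere $S^{r-1}$ (with $S^{-1}=\emptyset$), let $X$ be a topological space and $f:S^{r-1}\to X$ a continuous map. Let $X_f=X\cup_f D^r$ be the quotient space of $X\sqcup D^r$ by the equivalence relation generated by $y\sim f(y)$ for $y\in S^{r-1}$, and let $i:X\to X_f$ be the inclusion. Let $H_*$ denote singular homology, with $H_{-1}=0$. Let $[S^{r-1}]\in H_{r-1}(S^{r-1};\mathbb{Z})$ be a fundamental class of the sphere, that is, a generator of its reduced homology group in degree $r-1$, where the reduced group is the kernel of the map induced by $S^{r-1}\to\mathrm{pt}$ (so for $r=1$ the class is the difference of the two point classes, and for $r=0$ it is $0$). Such a class exists. Let $a_f=\langle f_*[S^{r-1}]\rangle\subset H_{r-1}(X;\mathbb{Z})$ be the cyclic subgroup generated by $f_*[S^{r-1}]$. Then: 1) $i_*:H_k(X;\mathbb{Z})\to H_k(X_f;\mathbb{Z})$ is an isomorphism for all $k\ne r,\,r-1$; 2) the sequence $$0\to a_f\to H_{r-1}(X;\mathbb{Z})\xrightarrow{\,i_*\,}H_{r-1}(X_f;\mathbb{Z})\to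 0$$ is exact, where the first map is the inclusion of the subgroup; 3) if $a_f$ is infinite, then $0\to H_r(X;\mathbb{Z})\xrightarrow{\,i_*\,}H_r(X_f;\mathbb{Z})\to 0$ is exact, i.e. $i_*$ is an isomorphism in degree $r$; if $a_f$ is finite, then there is a homomorphism $H_r(X_f;\mathbb{Z})\to\mathbb{Z}$ for which $$0\to H_r(X;\mathbb{Z})\xrightarrow{\,i_*\,}H_r(X_f;\mathbb{Z})\to\mathbb{Z}\to 0$$ is exact. -/

import Mathlib

open CategoryTheory AlgebraicTopology TopCat

universe u

noncomputable section

/-- The integral singular homology group `H_k(X; ℤ)` of a topological space. -/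
abbrev IntHomology (k : ℕ) (X : TopCat.{u}) : AddCommGrpCat.{u} :=
  ((singularHomologyFunctor AddCommGrpCat.{u} k).obj (AddCommGrpCat.of (ULift.{u} ℤ))).obj X

/-- The homomorphism `g_* : H_k(X; ℤ) → H_k(Y; ℤ)` induced by a continuous map `g : X → Y`. -/
def intHomologyMap (k : ℕ) {X Y : TopCat.{u}} (g : X ⟶ Y) :
    IntHomology k X →+ IntHomology k Y :=
  (((singularHomologyFunctor AddCommGrpCat.{u} k).obj
    (AddCommGrpCat.of (ULift.{u} ℤ))).map g).hom

/-- The reduced homology group of `X` in degree `k`, as the subgroup of `H_k(X; ℤ)` that is the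
kernel of the map induced by `X → pt`. It is all of `H_k(X; ℤ)` when `k > 0`. -/
def reducedIntHomology (k : ℕ) (X : TopCat.{u}) : AddSubgroup (IntHomology k X) :=
  (intHomologyMap k (TopCat.ofHom (ContinuousMap.const X PUnit.unit) :
    X ⟶ TopCat.of PUnit.{u + 1})).ker

/-- `e` is a fundamental class `[S^{r-1}]` of the sphere `S^{r-1} = ∂D^r` (for one of its two
orientations): a generator of the reduced homology group of `S^{r-1}` in degree `r - 1`.
For `r ≥ 2` this is a generator of `H_{r-1}(S^{r-1}; ℤ)`; for `r = 1` it is the difference of the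
classes of the two points of `S^0`. For `r = 0` the sphere is empty, and `e = 0` since all homology
groups of the empty space vanish (so the truncated degree `0 - 1 = 0` does no harm). -/
def IsSphereFundamentalClass (r : ℕ) (e : IntHomology (r - 1) (diskBoundary.{u} r)) : Prop :=
  AddSubgroup.zmultiples e = reducedIntHomology (r - 1) (diskBoundary.{u} r)

/-- The relation on the disjoint union `X ⊔ D^r` that identifies `y ∈ S^{r-1} ⊆ D^r` with
`f y ∈ X`. -/
inductive CellGlue (r : ℕ) {X : TopCat.{u}} (f : diskBoundary.{u} r ⟶ X) :
    X ⊕ disk.{u} r → X ⊕ disk.{u} r → Prop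
  | glue (y : diskBoundary.{u} r) :
      CellGlue r f (Sum.inr (diskBoundaryInclusion.{u} r y)) (Sum.inl (f y))

/-- The adjunction space `X_f = X ∪_f D^r`: the topological quotient of `X ⊔ D^r` by the equivalence
relation generated by `y ∼ f y` for `y ∈ S^{r-1}`. -/
def attachCell (r : ℕ) {X : TopCat.{u}} (f : diskBoundary.{u} r ⟶ X) : TopCat.{u} :=
  TopCat.of (Quot (CellGlue r f))

/-- The inclusion `i : X → X_f`. -/
def attachCellInclusion (r : ℕ) {X : TopCat.{u}} (f : diskBoundary.{u} r ⟶ X) :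
    X ⟶ attachCell r f :=
  TopCat.ofHom ⟨fun x => Quot.mk (CellGlue r f) (Sum.inl x),
    continuous_quot_mk.comp continuous_inl⟩

/-- The cyclic subgroup `a_f = ⟨f_* e⟩` of `H_{r-1}(X; ℤ)`, for a class `e` of `S^{r-1}`. -/
def attachingSubgroup (r : ℕ) {X : TopCat.{u}} (f : diskBoundary.{u} r ⟶ X)
    (e : IntHomology (r - 1) (diskBoundary.{u} r)) : AddSubgroup (IntHomology (r - 1) X) :=
  AddSubgroup.zmultiples (intHomologyMap (r - 1) f e)

/-- `0 → A → B → C → 0` is a short exact sequence of abelian groups. -/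
def IsShortExactSeq {A B C : Type*} [AddCommGroup A] [AddCommGroup B] [AddCommGroup C]
    (g : A →+ B) (h : B →+ C) : Prop :=
  Function.Injective g ∧ Function.Exact g h ∧ Function.Surjective h

end

/-!
The adjunction space `X_f` is covered by two open sets: the complement `U` of the centre of the
cell, and the open cell `V`. Pushing radially away from the centre deforms `U` onto `X`
(`AttachCell.bijective_puncturedBase`), `V` is star-shaped, and `U ∩ V` is a punctured ball, which
has the homology of `S^{r-1}` (`AttachCell.bijective_innerSphere`); under these identifications the
inclusion `U ∩ V → U` becomes `f` (`AttachCell.map_innerSphere`). Since `V` has the homology of a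
point, the Mayer-Vietoris sequence becomes a long exact sequence

  `⋯ → H_k(S^{r-1})~ → H_k(X) → H_k(X_f) → H_{k-1}(S^{r-1})~ → ⋯`

with reduced homology groups of the sphere, the first map being `f_*`
(`AttachCell.map_inclusion_eq_zero_iff` and `AttachCell.exists_connecting`). These reduced groups
vanish outside degree `r - 1`, where they are infinite cyclic, generated by the fundamental class
`e`. So `H_{r-1}(X_f)` is the quotient of `H_{r-1}(X)` by `⟨f_* e⟩`, and the cokernel of
`H_r(X) → H_r(X_f)` is the group of multiples `m • e` with `m • f_* e = 0`: it is trivial if `f_* e`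
has infinite order and is generated by `N • e` if `f_* e` has finite order `N`. For `r = 0` the
sphere is empty and `X_f` is the disjoint union of `X` and a point.

The two inputs are proved from the definition of singular homology. For the Mayer-Vietoris sequence
(`OpenCoverSquare.mayerVietoris`), barycentric subdivision is first treated combinatorially, on
formal combinations of tuples of vertices, where it is a chain map chain homotopic to the identity
by a cone construction (`TupleChain.bd_sdHomotopy`); composing simplices with affine maps carries
this over to singular chains, and the Lebesgue number lemma shows that iterated subdivision makes
each chain small (`exists_sub_d_mem_smallChains`). The homology of the sphere
(`isHomologySphere_diskBoundary`) is that of `ℝ^{n+1} \ {0}`, which is the union of the complements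
of two opposite closed half-lines; these are star-shaped and meet in `ℝ × (ℝ^n \ {0})`, so that
induction on `n` applies.
-/

noncomputable section

/-! ### Singular chains and the basis of singular simplices -/

section

open Limits Simplicial

/-- The integral singular chain complex whose homology is `IntHomology`. -/
abbrev singChains (X : TopCat.{u}) : ChainComplex AddCommGrpCat.{u} ℕ :=
  (TopCat.toSSet.obj X).chainComplex (AddCommGrpCat.of (ULift.{u} ℤ))

/-- The chain map induced by a continuous map. -/
abbrev singChainsMap {X Y : TopCat.{u}} (g : X ⟶ Y) : singChains X ⟶ singChains Y :=
  SSet.chainComplexMap (TopCat.toSSet.map g) (AddCommGrpCat.of (ULift.{u} ℤ))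

/-- The topological `n`-simplex. -/
abbrev TopSimplex (n : ℕ) : Type := stdSimplex ℝ (Fin (n + 1))

/-- The inclusion of the `i`-th face of the topological simplex. -/
def simplexFace {n : ℕ} (i : Fin (n + 2)) : C(TopSimplex n, TopSimplex (n + 1)) :=
  ⟨stdSimplex.map i.succAbove, stdSimplex.continuous_map _⟩

/-- The integral chain consisting of a single singular simplex. -/
def simplexChain {X : TopCat.{u}} {n : ℕ} (σ : C(TopSimplex n, X)) : (singChains X).X n :=
  ((TopCat.toSSet.obj X).ιChainComplex (R := AddCommGrpCat.of (ULift.{u} ℤ))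
    ((X.toSSetObjEquiv (.op ⦋n⦌)).symm σ)).hom (ULift.up 1)

theorem singChains_d_simplexChain {X : TopCat.{u}} {n : ℕ} (σ : C(TopSimplex (n + 1), X)) :
    ((singChains X).d (n + 1) n).hom (simplexChain σ) =
      ∑ i : Fin (n + 2), (-1 : ℤ) ^ (i : ℕ) • simplexChain (σ.comp (simplexFace i)) := by
  have h := (TopCat.toSSet.obj X).ιChainComplex_d (R := AddCommGrpCat.of (ULift.{u} ℤ))
    ((X.toSSetObjEquiv (.op ⦋n + 1⦌)).symm σ)
  let ev := (AddMonoidHom.eval (N := (singChains X).X n) (ULift.up.{u} (1 : ℤ))).comp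
    (AddCommGrpCat.homAddEquiv (M := AddCommGrpCat.of (ULift.{u} ℤ))).toAddMonoidHom
  refine (congrArg ev h).trans ?_
  rw [map_sum]
  exact Finset.sum_congr rfl fun i _ => map_zsmul ev _ _

theorem singChainsMap_simplexChain {X Y : TopCat.{u}} (g : X ⟶ Y) {n : ℕ}
    (σ : C(TopSimplex n, X)) :
    ((singChainsMap g).f n).hom (simplexChain σ) = simplexChain (g.hom.comp σ) := by
  have h := SSet.ι_chainComplexMap_f _ _ (TopCat.toSSet.map g)
    (AddCommGrpCat.of (ULift.{u} ℤ)) ((X.toSSetObjEquiv (.op ⦋n⦌)).symm σ)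
  exact congrArg (fun φ => φ.hom (ULift.up 1)) h

/-- The homomorphism out of the group of singular chains with prescribed values on simplices. -/
def simplexLift {X : TopCat.{u}} {n : ℕ} {M : Type u} [AddCommGroup M]
    (φ : C(TopSimplex n, X) → M) : (singChains X).X n →+ M :=
  ((Cofan.IsColimit.desc
    ((TopCat.toSSet.obj X).isColimitChainComplexXCofan (AddCommGrpCat.of (ULift.{u} ℤ)) n)
    (fun σ => AddCommGrpCat.ofHom
      (((zmultiplesHom M) (φ (X.toSSetObjEquiv (.op ⦋n⦌) σ))).comp
        AddEquiv.ulift.toAddMonoidHom))) : (singChains X).X n ⟶ AddCommGrpCat.of M).hom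

theorem simplexLift_simplexChain {X : TopCat.{u}} {n : ℕ} {M : Type u} [AddCommGroup M]
    (φ : C(TopSimplex n, X) → M) (σ : C(TopSimplex n, X)) :
    simplexLift φ (simplexChain σ) = φ σ := by
  have h := Cofan.IsColimit.fac
    ((TopCat.toSSet.obj X).isColimitChainComplexXCofan (AddCommGrpCat.of (ULift.{u} ℤ)) n)
    (fun σ => AddCommGrpCat.ofHom
      (((zmultiplesHom M) (φ (X.toSSetObjEquiv (.op ⦋n⦌) σ))).comp
        AddEquiv.ulift.toAddMonoidHom)) ((X.toSSetObjEquiv (.op ⦋n⦌)).symm σ)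
  refine (congrArg (fun φ => φ.hom (ULift.up 1)) h).trans ?_
  simp only [Equiv.apply_symm_apply]
  exact one_zsmul (φ σ)

theorem singChains_hom_ext {X : TopCat.{u}} {n : ℕ} {M : Type u} [AddCommGroup M]
    {φ ψ : (singChains X).X n →+ M}
    (h : ∀ σ : C(TopSimplex n, X), φ (simplexChain σ) = ψ (simplexChain σ)) : φ = ψ := by
  have : AddCommGrpCat.ofHom φ = AddCommGrpCat.ofHom ψ := by
    refine SSet.chainComplex_hom_ext (X := TopCat.toSSet.obj X) (T := AddCommGrpCat.of M)
      (R := AddCommGrpCat.of (ULift.{u} ℤ)) fun x => ?_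
    obtain ⟨σ, rfl⟩ := (X.toSSetObjEquiv (.op ⦋n⦌)).symm.surjective x
    ext ⟨k⟩
    have hk : (ULift.up.{u} k) = k • ULift.up.{u} (1 : ℤ) := by
      ext; simp
    rw [hk, map_zsmul, map_zsmul]
    exact congrArg (k • ·) (h σ)
  exact congrArg AddCommGrpCat.Hom.hom this

/-- Singular simplices form a basis of the group of singular chains. -/
def simplexBasis (X : TopCat.{u}) (n : ℕ) :
    Module.Basis C(TopSimplex n, X) ℤ ((singChains X).X n) :=
  .ofRepr <| AddEquiv.toIntLinearEquiv <|
    { simplexLift (fun σ => Finsupp.single σ (1 : ℤ)) with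
      invFun := Finsupp.lift _ ℤ _ simplexChain
      left_inv := fun x => DFunLike.congr_fun (singChains_hom_ext
        (φ := (Finsupp.lift _ ℤ _ simplexChain).toAddMonoidHom.comp
          (simplexLift (fun σ => Finsupp.single σ (1 : ℤ))))
        (ψ := .id _) fun σ => by
          change Finsupp.lift _ ℤ _ simplexChain (simplexLift _ (simplexChain σ)) = simplexChain σ
          rw [simplexLift_simplexChain]; simp) x
      right_inv := fun x => by
        change simplexLift _ (Finsupp.lift _ ℤ _ simplexChain x) = x
        induction x using Finsupp.induction_linear with
        | zero => simp
        | add f g hf hg => rw [map_add, map_add, hf, hg]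
        | single a b =>
          simp only [Finsupp.lift_apply, zero_smul, Finsupp.sum_single_index]
          rw [map_zsmul, simplexLift_simplexChain]
          simp }

@[simp]
theorem simplexBasis_apply {X : TopCat.{u}} {n : ℕ} (σ : C(TopSimplex n, X)) :
    simplexBasis X n σ = simplexChain σ := by
  refine (simplexBasis X n).repr.injective ?_
  rw [Module.Basis.repr_self]
  exact (simplexLift_simplexChain (fun σ => Finsupp.single σ (1 : ℤ)) σ).symm

end

/-! ### Subdivision of chains of tuples -/

namespace TupleChain

section Tuples

variable {K L : Type*}

/-- To map all chains supported on `S` into `N`, it is enough to do so for the members of `S`. -/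
theorem map_mem_of_supported {α M : Type*} [AddCommGroup M] {S : Set α} {N : Submodule ℤ M}
    (φ : (α →₀ ℤ) →ₗ[ℤ] M) (h : ∀ a ∈ S, φ (Finsupp.single a 1) ∈ N) {c : α →₀ ℤ}
    (hc : c ∈ Finsupp.supported ℤ ℤ S) : φ c ∈ N := by
  rw [Finsupp.supported_eq_span_single] at hc
  refine Submodule.span_le (p := N.comap φ).2 ?_ hc
  rintro _ ⟨a, ha, rfl⟩
  exact h a ha

/-- The boundary of the augmented complex of tuples: omit one entry at a time. -/
def bd (n : ℕ) : ((Fin (n + 1) → K) →₀ ℤ) →ₗ[ℤ] ((Fin n → K) →₀ ℤ) :=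
  Finsupp.linearCombination ℤ fun v =>
    ∑ i : Fin (n + 1), (-1 : ℤ) ^ (i : ℕ) • Finsupp.single (v ∘ i.succAbove) 1

theorem bd_single (n : ℕ) (v : Fin (n + 1) → K) :
    bd n (Finsupp.single v 1) =
      ∑ i : Fin (n + 1), (-1 : ℤ) ^ (i : ℕ) • Finsupp.single (v ∘ i.succAbove) 1 := by
  simp [bd]

/-- The cone with apex `b`: prepend `b` to each tuple. -/
def cone (n : ℕ) (b : K) : ((Fin n → K) →₀ ℤ) →ₗ[ℤ] ((Fin (n + 1) → K) →₀ ℤ) :=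
  Finsupp.lmapDomain ℤ ℤ fun v => (Fin.cons b v : Fin (n + 1) → K)

theorem cone_single (n : ℕ) (b : K) (v : Fin n → K) :
    cone n b (Finsupp.single v 1) = Finsupp.single (Fin.cons b v : Fin (n + 1) → K) 1 := by
  simp [cone]

theorem bd_cone_zero (b : K) (c : (Fin 0 → K) →₀ ℤ) : bd 0 (cone 0 b c) = c := by
  suffices bd 0 ∘ₗ cone 0 b = LinearMap.id from LinearMap.congr_fun this c
  refine Finsupp.lhom_ext' fun v => LinearMap.ext_ring ?_
  simp only [LinearMap.comp_apply, Finsupp.lsingle_apply, cone_single, bd_single,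
    LinearMap.id_apply]
  refine (Fin.sum_univ_one _).trans ?_
  rw [Fin.val_zero, pow_zero, one_smul]
  congr 1

theorem bd_cone (n : ℕ) (b : K) (c : (Fin (n + 1) → K) →₀ ℤ) :
    bd (n + 1) (cone (n + 1) b c) = c - cone n b (bd n c) := by
  suffices bd (n + 1) ∘ₗ cone (n + 1) b = LinearMap.id - cone n b ∘ₗ bd n from
    LinearMap.congr_fun this c
  refine Finsupp.lhom_ext' fun v => LinearMap.ext_ring ?_
  simp only [LinearMap.comp_apply, Finsupp.lsingle_apply, cone_single, bd_single,
    LinearMap.id_apply, LinearMap.sub_apply, map_sum, map_smul]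
  rw [Fin.sum_univ_succ, sub_eq_add_neg, ← Finset.sum_neg_distrib]
  congr 1
  · simp only [Fin.val_zero, pow_zero, one_smul]
    congr 1
  · refine Finset.sum_congr rfl fun i _ => ?_
    rw [Fin.val_succ, pow_succ, mul_neg_one, neg_smul]
    congr 3
    ext j
    refine Fin.cases ?_ (fun j => ?_) j
    · simp
    · simp

theorem bd_bd (n : ℕ) (c : (Fin (n + 2) → K) →₀ ℤ) : bd n (bd (n + 1) c) = 0 := by
  induction n with
  | zero =>
    suffices bd 0 ∘ₗ bd 1 = (0 : ((Fin 2 → K) →₀ ℤ) →ₗ[ℤ] _) from LinearMap.congr_fun this c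
    refine Finsupp.lhom_ext' fun v => LinearMap.ext_ring ?_
    obtain ⟨b, v, rfl⟩ : ∃ b w, v = Fin.cons b w := ⟨_, _, (Fin.cons_self_tail v).symm⟩
    simp only [LinearMap.comp_apply, Finsupp.lsingle_apply, ← cone_single]
    rw [bd_cone, map_sub, bd_cone_zero, sub_self]; rfl
  | succ n ih =>
    suffices bd (n + 1) ∘ₗ bd (n + 2) = (0 : ((Fin (n + 3) → K) →₀ ℤ) →ₗ[ℤ] _) from
      LinearMap.congr_fun this c
    refine Finsupp.lhom_ext' fun v => LinearMap.ext_ring ?_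
    obtain ⟨b, v, rfl⟩ : ∃ b w, v = Fin.cons b w := ⟨_, _, (Fin.cons_self_tail v).symm⟩
    simp only [LinearMap.comp_apply, Finsupp.lsingle_apply, ← cone_single]
    rw [bd_cone, map_sub, bd_cone, ih, map_zero, sub_zero, sub_self]; rfl

/-- Subdivision of tuples, with respect to a choice `β` of a centre of each nonempty tuple: the
tuple is replaced by the cone from its centre over its subdivided boundary. -/
def sd (β : ∀ n, (Fin (n + 1) → K) → K) : ∀ n, ((Fin n → K) →₀ ℤ) →ₗ[ℤ] ((Fin n → K) →₀ ℤ)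
  | 0 => LinearMap.id
  | n + 1 => Finsupp.linearCombination ℤ fun v =>
      cone n (β n v) (sd β n (bd n (Finsupp.single v 1)))

/-- The chain homotopy from the identity to `sd`. -/
def sdHomotopy (β : ∀ n, (Fin (n + 1) → K) → K) :
    ∀ n, ((Fin n → K) →₀ ℤ) →ₗ[ℤ] ((Fin (n + 1) → K) →₀ ℤ)
  | 0 => 0
  | n + 1 => Finsupp.linearCombination ℤ fun v =>
      cone (n + 1) (β n v) (Finsupp.single v 1 - sdHomotopy β n (bd n (Finsupp.single v 1)))

variable (β : ∀ n, (Fin (n + 1) → K) → K)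

theorem sd_single (n : ℕ) (v : Fin (n + 1) → K) :
    sd β (n + 1) (Finsupp.single v 1) = cone n (β n v) (sd β n (bd n (Finsupp.single v 1))) := by
  simp [sd]

theorem sdHomotopy_single (n : ℕ) (v : Fin (n + 1) → K) :
    sdHomotopy β (n + 1) (Finsupp.single v 1) =
      cone (n + 1) (β n v) (Finsupp.single v 1 - sdHomotopy β n (bd n (Finsupp.single v 1))) := by
  simp [sdHomotopy]

theorem bd_sd (n : ℕ) (c : (Fin (n + 1) → K) →₀ ℤ) : bd n (sd β (n + 1) c) = sd β n (bd n c) := by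
  induction n with
  | zero =>
    suffices bd 0 ∘ₗ sd β 1 = sd β 0 ∘ₗ bd 0 from LinearMap.congr_fun this c
    refine Finsupp.lhom_ext' fun v => LinearMap.ext_ring ?_
    simp only [LinearMap.comp_apply, Finsupp.lsingle_apply, sd_single, bd_cone_zero]
  | succ n ih =>
    suffices bd (n + 1) ∘ₗ sd β (n + 2) = sd β (n + 1) ∘ₗ bd (n + 1) from
      LinearMap.congr_fun this c
    refine Finsupp.lhom_ext' fun v => LinearMap.ext_ring ?_
    simp only [LinearMap.comp_apply, Finsupp.lsingle_apply, sd_single]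
    rw [bd_cone, ih, bd_bd, map_zero, map_zero, sub_zero]

theorem bd_sdHomotopy (n : ℕ) (c : (Fin (n + 1) → K) →₀ ℤ) :
    bd (n + 1) (sdHomotopy β (n + 1) c) = c - sd β (n + 1) c - sdHomotopy β n (bd n c) := by
  induction n with
  | zero =>
    suffices bd 1 ∘ₗ sdHomotopy β 1 = LinearMap.id - sd β 1 - sdHomotopy β 0 ∘ₗ bd 0 from
      LinearMap.congr_fun this c
    refine Finsupp.lhom_ext' fun v => LinearMap.ext_ring ?_
    simp only [LinearMap.comp_apply, Finsupp.lsingle_apply, sd_single, sdHomotopy_single,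
      LinearMap.sub_apply, LinearMap.id_apply, bd_cone]
    simp [sdHomotopy, sd]
  | succ n ih =>
    suffices bd (n + 2) ∘ₗ sdHomotopy β (n + 2) =
        LinearMap.id - sd β (n + 2) - sdHomotopy β (n + 1) ∘ₗ bd (n + 1) from
      LinearMap.congr_fun this c
    refine Finsupp.lhom_ext' fun v => LinearMap.ext_ring ?_
    simp only [LinearMap.comp_apply, Finsupp.lsingle_apply, sd_single, sdHomotopy_single,
      LinearMap.sub_apply, LinearMap.id_apply]
    rw [bd_cone, map_sub (bd (n + 1)), ih, bd_bd, map_zero, sub_zero, sub_sub_cancel]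
    abel

/-- The chain map induced by a map of vertices. -/
def push (n : ℕ) (g : K → L) : ((Fin n → K) →₀ ℤ) →ₗ[ℤ] ((Fin n → L) →₀ ℤ) :=
  Finsupp.lmapDomain ℤ ℤ (g ∘ ·)

theorem push_single (n : ℕ) (g : K → L) (v : Fin n → K) :
    push n g (Finsupp.single v 1) = Finsupp.single (g ∘ v) 1 := by
  simp [push]

theorem push_bd (n : ℕ) (g : K → L) (c : (Fin (n + 1) → K) →₀ ℤ) :
    push n g (bd n c) = bd n (push (n + 1) g c) := by
  suffices push n g ∘ₗ bd n = bd n ∘ₗ push (n + 1) g from LinearMap.congr_fun this c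
  refine Finsupp.lhom_ext' fun v => LinearMap.ext_ring ?_
  simp only [LinearMap.comp_apply, Finsupp.lsingle_apply, push_single, bd_single, map_sum, map_smul]
  rfl

theorem push_cone (n : ℕ) (g : K → L) (b : K) (c : (Fin n → K) →₀ ℤ) :
    push (n + 1) g (cone n b c) = cone n (g b) (push n g c) := by
  suffices push (n + 1) g ∘ₗ cone n b = cone n (g b) ∘ₗ push n g from LinearMap.congr_fun this c
  refine Finsupp.lhom_ext' fun v => LinearMap.ext_ring ?_
  simp only [LinearMap.comp_apply, Finsupp.lsingle_apply, push_single, cone_single]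
  congr 1
  ext i
  refine Fin.cases ?_ (fun i => ?_) i <;> simp

variable {β} {γ : ∀ n, (Fin (n + 1) → L) → L} {g : K → L}

theorem push_sd (hg : ∀ n v, g (β n v) = γ n (g ∘ v)) (n : ℕ) (c : (Fin n → K) →₀ ℤ) :
    push n g (sd β n c) = sd γ n (push n g c) := by
  induction n with
  | zero => rfl
  | succ n ih =>
    suffices push (n + 1) g ∘ₗ sd β (n + 1) = sd γ (n + 1) ∘ₗ push (n + 1) g from
      LinearMap.congr_fun this c
    refine Finsupp.lhom_ext' fun v => LinearMap.ext_ring ?_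
    simp only [LinearMap.comp_apply, Finsupp.lsingle_apply, push_single, sd_single]
    rw [push_cone, ih, hg, push_bd, push_single]

theorem push_sdHomotopy (hg : ∀ n v, g (β n v) = γ n (g ∘ v)) (n : ℕ) (c : (Fin n → K) →₀ ℤ) :
    push (n + 1) g (sdHomotopy β n c) = sdHomotopy γ n (push n g c) := by
  induction n with
  | zero => simp [sdHomotopy]
  | succ n ih =>
    suffices push (n + 2) g ∘ₗ sdHomotopy β (n + 1) = sdHomotopy γ (n + 1) ∘ₗ push (n + 1) g from
      LinearMap.congr_fun this c
    refine Finsupp.lhom_ext' fun v => LinearMap.ext_ring ?_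
    simp only [LinearMap.comp_apply, Finsupp.lsingle_apply, push_single, sdHomotopy_single]
    rw [push_cone, map_sub, ih, hg, push_bd, push_single]

end Tuples

section Diameter

variable {K : Type*}

theorem cone_mem_supported {n : ℕ} {b : K} {c : (Fin n → K) →₀ ℤ} {S : Set (Fin n → K)}
    {S' : Set (Fin (n + 1) → K)} (h : ∀ v ∈ S, (Fin.cons b v : Fin (n + 1) → K) ∈ S')
    (hc : c ∈ Finsupp.supported ℤ ℤ S) : cone n b c ∈ Finsupp.supported ℤ ℤ S' :=
  map_mem_of_supported _ (fun v hv => by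
    rw [cone_single]; exact Finsupp.single_mem_supported ℤ _ (h v hv)) hc

variable [PseudoMetricSpace K] {β : ∀ n, (Fin (n + 1) → K) → K}

/-- The simplices in the subdivision of `v` stay in every ball that contains `v`, and are shorter
than `v` by the factor `n / (n + 1)`. -/
theorem sd_single_mem_supported
    (hβ : ∀ n v p, dist p (β n v) ≤ (∑ j, dist p (v j)) / (n + 1)) (n : ℕ) (v : Fin (n + 1) → K)
    {D : ℝ} (hD : 0 ≤ D) (hv : ∀ i j, dist (v i) (v j) ≤ D) :
    sd β (n + 1) (Finsupp.single v 1) ∈ Finsupp.supported ℤ ℤ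
      {w | (∀ p r, (∀ j, dist p (v j) ≤ r) → ∀ i, dist p (w i) ≤ r) ∧
        ∀ i j, dist (w i) (w j) ≤ n / (n + 1) * D} := by
  have hball : ∀ p r, (∀ j, dist p (v j) ≤ r) → dist p (β n v) ≤ r := by
    intro p r h
    refine (hβ n v p).trans ?_
    rw [div_le_iff₀ (by positivity)]
    refine (Finset.sum_le_card_nsmul _ _ r fun j _ => h j).trans ?_
    simp; linarith
  -- One of the `n + 1` distances to be averaged is zero; this yields the factor `n / (n + 1)`.
  have hcenter : ∀ j, dist (β n v) (v j) ≤ n / (n + 1) * D := by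
    intro j
    rw [dist_comm]
    refine (hβ n v _).trans ?_
    rw [div_mul_eq_mul_div, div_le_div_iff_of_pos_right (by positivity),
      ← Finset.add_sum_erase _ _ (Finset.mem_univ j), dist_self, zero_add]
    refine (Finset.sum_le_card_nsmul _ _ D fun k _ => hv j k).trans ?_
    simp
  rw [sd_single]
  cases n with
  | zero =>
    refine cone_mem_supported (S := Set.univ) ?_ (by simp)
    intro w _
    have h1 : ∀ i : Fin (0 + 1), i = 0 := fun i => Fin.fin_one_eq_zero i
    refine ⟨fun p r h i => ?_, fun i j => ?_⟩
    · rw [h1 i]; exact hball p r h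
    · rw [h1 i, h1 j]; simp
  | succ n =>
    refine cone_mem_supported (S := {w | (∀ p r, (∀ j, dist p (v j) ≤ r) → ∀ i, dist p (w i) ≤ r) ∧
        ∀ i j, dist (w i) (w j) ≤ n / (n + 1) * D}) ?_ ?_
    · rintro w ⟨hw₁, hw₂⟩
      have hle : (n / (n + 1) * D : ℝ) ≤ (n + 1 : ℕ) / ((n + 1 : ℕ) + 1) * D := by
        refine mul_le_mul_of_nonneg_right ?_ hD
        rw [div_le_div_iff₀ (by positivity) (by positivity)]
        push_cast; nlinarith
      have hb := hw₁ _ _ hcenter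
      refine ⟨fun p r h i => ?_, fun i j => ?_⟩
      · refine Fin.cases ?_ (fun i => ?_) i
        · exact hball p r h
        · exact hw₁ p r h i
      · refine Fin.cases ?_ (fun i => ?_) i <;> refine Fin.cases ?_ (fun j => ?_) j
        · simp only [Fin.cons_zero, dist_self]; positivity
        · exact hb j
        · simp only [Fin.cons_zero, Fin.cons_succ]; rw [dist_comm]; exact hb i
        · exact (hw₂ i j).trans hle
    · rw [bd_single, map_sum]
      refine Submodule.sum_mem _ fun i _ => ?_
      rw [map_smul]
      refine Submodule.smul_mem _ _ (Finsupp.supported_mono ?_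
        (sd_single_mem_supported hβ n (v ∘ i.succAbove) hD (fun _ _ => hv _ _)))
      rintro w ⟨h₁, h₂⟩
      exact ⟨fun p r h => h₁ p r fun j => h _, h₂⟩

/-- After `m` subdivisions the diameters have shrunk by the factor `(n / (n + 1)) ^ m`. -/
theorem iterate_sd_mem_supported
    (hβ : ∀ n v p, dist p (β n v) ≤ (∑ j, dist p (v j)) / (n + 1)) (n m : ℕ)
    {D : ℝ} (hD : 0 ≤ D) {c : (Fin (n + 1) → K) →₀ ℤ}
    (hc : c ∈ Finsupp.supported ℤ ℤ {v | ∀ i j, dist (v i) (v j) ≤ D}) :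
    (sd β (n + 1))^[m] c ∈ Finsupp.supported ℤ ℤ
      {w | ∀ i j, dist (w i) (w j) ≤ (n / (n + 1)) ^ m * D} := by
  induction m with
  | zero => simpa using hc
  | succ m ih =>
    rw [Function.iterate_succ_apply']
    refine map_mem_of_supported _ (fun v hv => ?_) ih
    refine Finsupp.supported_mono ?_ (sd_single_mem_supported hβ n v (by positivity) hv)
    rintro w ⟨-, h⟩ i j
    rw [pow_succ', mul_assoc]
    exact h i j

end Diameter

end TupleChain

/-! ### Barycentric subdivision and small chains -/

section

open TupleChain

/-- The affine map between simplices with prescribed images of the vertices. -/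
def affineSimplex {n m : ℕ} (v : Fin (n + 1) → TopSimplex m) : C(TopSimplex n, TopSimplex m) where
  toFun t := ⟨∑ i, t i • (v i : Fin (m + 1) → ℝ),
    (convex_stdSimplex ℝ _).sum_mem (fun i _ => t.2.1 i) t.2.2 fun i _ => (v i).2⟩
  continuous_toFun := by
    refine Continuous.subtype_mk (continuous_finsetSum _ fun i _ => ?_) _
    exact ((continuous_apply i).comp continuous_subtype_val).smul continuous_const

theorem affineSimplex_apply {n m : ℕ} (v : Fin (n + 1) → TopSimplex m) (t : TopSimplex n)
    (j : Fin (m + 1)) : affineSimplex v t j = ∑ i, t i * v i j := by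
  change (∑ i, t i • (v i : Fin (m + 1) → ℝ)) j = _
  simp [Finset.sum_apply]

theorem affineSimplex_comp {n m k : ℕ} (w : Fin (m + 1) → TopSimplex k)
    (v : Fin (n + 1) → TopSimplex m) :
    (affineSimplex w).comp (affineSimplex v) = affineSimplex (affineSimplex w ∘ v) := by
  ext t j
  change affineSimplex w (affineSimplex v t) j = affineSimplex (affineSimplex w ∘ v) t j
  simp only [affineSimplex_apply, Function.comp_apply, Finset.sum_mul, Finset.mul_sum]
  rw [Finset.sum_comm]
  simp only [mul_assoc]

theorem affineSimplex_vertex {n m : ℕ} (v : Fin (n + 1) → TopSimplex m) (i : Fin (n + 1)) :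
    affineSimplex v (stdSimplex.vertex i) = v i := by
  ext j
  change affineSimplex v (stdSimplex.vertex i) j = v i j
  rw [affineSimplex_apply, Finset.sum_eq_single i]
  · change (Pi.single i (1 : ℝ) : Fin (n + 1) → ℝ) i * _ = _
    simp
  · intro k _ hk
    change (Pi.single i (1 : ℝ) : Fin (n + 1) → ℝ) k * _ = _
    simp [hk]
  · simp

theorem affineSimplex_vertices (n : ℕ) :
    affineSimplex (stdSimplex.vertex (S := ℝ) (X := Fin (n + 1))) = ContinuousMap.id _ := by
  ext t j
  change affineSimplex _ t j = t j
  rw [affineSimplex_apply, Finset.sum_eq_single j]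
  · change _ * (Pi.single j (1 : ℝ) : Fin (n + 1) → ℝ) j = _
    simp
  · intro k _ hk
    change _ * (Pi.single k (1 : ℝ) : Fin (n + 1) → ℝ) j = _
    simp [hk.symm]
  · simp

theorem affineSimplex_comp_simplexFace {n m : ℕ} (v : Fin (n + 2) → TopSimplex m)
    (i : Fin (n + 2)) :
    (affineSimplex v).comp (simplexFace i) = affineSimplex (v ∘ i.succAbove) := by
  have : simplexFace i = affineSimplex (stdSimplex.vertex (S := ℝ) ∘ i.succAbove) := by
    ext t j
    change (stdSimplex.map i.succAbove t) j = affineSimplex _ t j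
    rw [affineSimplex_apply]
    change (FunOnFinite.linearMap ℝ ℝ i.succAbove t) j = _
    rw [FunOnFinite.linearMap_apply_apply, Finset.sum_filter]
    refine Finset.sum_congr rfl fun k _ => ?_
    change _ = _ * (Pi.single (i.succAbove k) (1 : ℝ) : Fin (n + 2) → ℝ) j
    rw [Pi.single_apply]
    simp [eq_comm]
  rw [this, affineSimplex_comp]
  congr 1
  ext1 k
  simp [affineSimplex_vertex]

theorem dist_affineSimplex_le {n m : ℕ} (v : Fin (n + 1) → TopSimplex m) (t : TopSimplex n)
    (p : TopSimplex m) : dist p (affineSimplex v t) ≤ ∑ i, t i * dist p (v i) := by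
  have hp : (p : Fin (m + 1) → ℝ) = ∑ i, t i • (p : Fin (m + 1) → ℝ) := by
    rw [← Finset.sum_smul]
    have : ∑ i, t i = 1 := stdSimplex.sum_eq_one t
    rw [this, one_smul]
  rw [Subtype.dist_eq, dist_eq_norm]
  change ‖(p : Fin (m + 1) → ℝ) - ∑ i, t i • (v i : Fin (m + 1) → ℝ)‖ ≤ _
  rw [hp, ← Finset.sum_sub_distrib]
  refine (norm_sum_le _ _).trans (Finset.sum_le_sum fun i _ => ?_)
  rw [← smul_sub, norm_smul, Real.norm_of_nonneg (stdSimplex.zero_le t i), Subtype.dist_eq,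
    dist_eq_norm]
  rfl

/-- The barycenter of a tuple of points of a simplex. -/
def tupleBarycenter {m : ℕ} (n : ℕ) (v : Fin (n + 1) → TopSimplex m) : TopSimplex m :=
  affineSimplex v stdSimplex.barycenter

theorem affineSimplex_tupleBarycenter {m k : ℕ} (w : Fin (m + 1) → TopSimplex k) (n : ℕ)
    (v : Fin (n + 1) → TopSimplex m) :
    affineSimplex w (tupleBarycenter n v) = tupleBarycenter n (affineSimplex w ∘ v) :=
  DFunLike.congr_fun (affineSimplex_comp w v) _

theorem dist_tupleBarycenter_le {m : ℕ} (n : ℕ) (v : Fin (n + 1) → TopSimplex m)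
    (p : TopSimplex m) : dist p (tupleBarycenter n v) ≤ (∑ j, dist p (v j)) / (n + 1) := by
  refine (dist_affineSimplex_le v _ p).trans (le_of_eq ?_)
  rw [Finset.sum_div]
  refine Finset.sum_congr rfl fun i _ => ?_
  change (stdSimplex.barycenter (𝕜 := ℝ) (X := Fin (n + 1))).1 i * _ = _
  rw [stdSimplex.barycenter_apply]
  simp [div_eq_inv_mul]

section Subdivision

variable {X Y : TopCat.{u}} {m : ℕ}

/-- The singular chain obtained from a chain of tuples in a simplex by composing the affine maps
with these vertices with `σ`. -/
def affineChain (σ : C(TopSimplex m, X)) (n : ℕ) :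
    ((Fin (n + 1) → TopSimplex m) →₀ ℤ) →ₗ[ℤ] (singChains X).X n :=
  Finsupp.linearCombination ℤ fun v => simplexChain (σ.comp (affineSimplex v))

theorem affineChain_single (σ : C(TopSimplex m, X)) (n : ℕ) (v : Fin (n + 1) → TopSimplex m) :
    affineChain σ n (Finsupp.single v 1) = simplexChain (σ.comp (affineSimplex v)) := by
  simp [affineChain]

theorem affineChain_vertex (σ : C(TopSimplex m, X)) :
    affineChain σ m (Finsupp.single stdSimplex.vertex 1) = simplexChain σ := by
  rw [affineChain_single, affineSimplex_vertices, ContinuousMap.comp_id]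

theorem d_affineChain (σ : C(TopSimplex m, X)) (n : ℕ)
    (c : (Fin (n + 2) → TopSimplex m) →₀ ℤ) :
    ((singChains X).d (n + 1) n).hom (affineChain σ (n + 1) c) =
      affineChain σ n (bd (n + 1) c) := by
  suffices ((singChains X).d (n + 1) n).hom.toIntLinearMap ∘ₗ affineChain σ (n + 1) =
      affineChain σ n ∘ₗ bd (n + 1) from LinearMap.congr_fun this c
  refine Finsupp.lhom_ext' fun v => LinearMap.ext_ring ?_
  simp only [LinearMap.comp_apply, Finsupp.lsingle_apply, affineChain_single, bd_single, map_sum,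
    map_smul]
  refine (singChains_d_simplexChain _).trans ?_
  refine Finset.sum_congr rfl fun i _ => ?_
  rw [ContinuousMap.comp_assoc, affineSimplex_comp_simplexFace]

theorem affineChain_comp (σ : C(TopSimplex m, X)) {k : ℕ} (w : Fin (k + 1) → TopSimplex m) (n : ℕ)
    (c : (Fin (n + 1) → TopSimplex k) →₀ ℤ) :
    affineChain (σ.comp (affineSimplex w)) n c =
      affineChain σ n (push (n + 1) (affineSimplex w) c) := by
  suffices affineChain (σ.comp (affineSimplex w)) n =
      affineChain σ n ∘ₗ push (n + 1) (affineSimplex w) from LinearMap.congr_fun this c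
  refine Finsupp.lhom_ext' fun v => LinearMap.ext_ring ?_
  simp only [LinearMap.comp_apply, Finsupp.lsingle_apply, affineChain_single, push_single]
  rw [ContinuousMap.comp_assoc, affineSimplex_comp]

/-- Barycentric subdivision of singular chains. -/
def subdivide (X : TopCat.{u}) (n : ℕ) : (singChains X).X n →+ (singChains X).X n :=
  simplexLift fun σ =>
    affineChain σ n (sd tupleBarycenter (n + 1) (Finsupp.single stdSimplex.vertex 1))

/-- The natural chain homotopy from the identity to barycentric subdivision. -/
def subdivideHomotopy (X : TopCat.{u}) (n : ℕ) : (singChains X).X n →+ (singChains X).X (n + 1) :=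
  simplexLift fun σ =>
    affineChain σ (n + 1) (sdHomotopy tupleBarycenter (n + 1) (Finsupp.single stdSimplex.vertex 1))

theorem subdivide_simplexChain {n : ℕ} (σ : C(TopSimplex n, X)) :
    subdivide X n (simplexChain σ) =
      affineChain σ n (sd tupleBarycenter (n + 1) (Finsupp.single stdSimplex.vertex 1)) :=
  simplexLift_simplexChain (M := (singChains X).X n) _ σ

theorem subdivide_affineChain (σ : C(TopSimplex m, X)) (n : ℕ)
    (c : (Fin (n + 1) → TopSimplex m) →₀ ℤ) :
    subdivide X n (affineChain σ n c) = affineChain σ n (sd tupleBarycenter (n + 1) c) := by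
  suffices (subdivide X n).toIntLinearMap ∘ₗ affineChain σ n =
      affineChain σ n ∘ₗ sd tupleBarycenter (n + 1) from LinearMap.congr_fun this c
  refine Finsupp.lhom_ext' fun v => LinearMap.ext_ring ?_
  simp only [LinearMap.comp_apply, Finsupp.lsingle_apply, affineChain_single]
  refine (subdivide_simplexChain _).trans ?_
  rw [affineChain_comp, push_sd (affineSimplex_tupleBarycenter v), push_single]
  congr 3
  ext1 i
  exact affineSimplex_vertex v i

theorem subdivideHomotopy_simplexChain {n : ℕ} (σ : C(TopSimplex n, X)) :
    subdivideHomotopy X n (simplexChain σ) = affineChain σ (n + 1)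
      (sdHomotopy tupleBarycenter (n + 1) (Finsupp.single stdSimplex.vertex 1)) :=
  simplexLift_simplexChain (M := (singChains X).X (n + 1)) _ σ

theorem subdivideHomotopy_affineChain (σ : C(TopSimplex m, X)) (n : ℕ)
    (c : (Fin (n + 1) → TopSimplex m) →₀ ℤ) :
    subdivideHomotopy X n (affineChain σ n c) =
      affineChain σ (n + 1) (sdHomotopy tupleBarycenter (n + 1) c) := by
  suffices (subdivideHomotopy X n).toIntLinearMap ∘ₗ affineChain σ n =
      affineChain σ (n + 1) ∘ₗ sdHomotopy tupleBarycenter (n + 1) from LinearMap.congr_fun this c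
  refine Finsupp.lhom_ext' fun v => LinearMap.ext_ring ?_
  simp only [LinearMap.comp_apply, Finsupp.lsingle_apply, affineChain_single]
  refine (subdivideHomotopy_simplexChain _).trans ?_
  rw [affineChain_comp, push_sdHomotopy (affineSimplex_tupleBarycenter v), push_single]
  congr 3
  ext1 i
  exact affineSimplex_vertex v i

theorem d_subdivide (n : ℕ) (c : (singChains X).X (n + 1)) :
    ((singChains X).d (n + 1) n).hom (subdivide X (n + 1) c) =
      subdivide X n (((singChains X).d (n + 1) n).hom c) := by
  suffices ((singChains X).d (n + 1) n).hom.comp (subdivide X (n + 1)) =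
      (subdivide X n).comp ((singChains X).d (n + 1) n).hom from DFunLike.congr_fun this c
  refine singChains_hom_ext fun σ => ?_
  simp only [AddMonoidHom.comp_apply, ← affineChain_vertex σ]
  rw [subdivide_affineChain, d_affineChain, d_affineChain, subdivide_affineChain, bd_sd]

theorem d_subdivideHomotopy_zero (c : (singChains X).X 0) :
    ((singChains X).d 1 0).hom (subdivideHomotopy X 0 c) = c - subdivide X 0 c := by
  suffices ((singChains X).d 1 0).hom.comp (subdivideHomotopy X 0) =
      AddMonoidHom.id _ - subdivide X 0 from DFunLike.congr_fun this c
  refine singChains_hom_ext fun σ => ?_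
  simp only [AddMonoidHom.comp_apply, AddMonoidHom.sub_apply, AddMonoidHom.id_apply,
    ← affineChain_vertex σ]
  rw [subdivideHomotopy_affineChain, d_affineChain, subdivide_affineChain, bd_sdHomotopy]
  simp [sdHomotopy]

theorem d_subdivideHomotopy (n : ℕ) (c : (singChains X).X (n + 1)) :
    ((singChains X).d (n + 2) (n + 1)).hom (subdivideHomotopy X (n + 1) c) =
      c - subdivide X (n + 1) c - subdivideHomotopy X n (((singChains X).d (n + 1) n).hom c) := by
  suffices ((singChains X).d (n + 2) (n + 1)).hom.comp (subdivideHomotopy X (n + 1)) =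
      AddMonoidHom.id _ - subdivide X (n + 1) -
        (subdivideHomotopy X n).comp ((singChains X).d (n + 1) n).hom from
    DFunLike.congr_fun this c
  refine singChains_hom_ext fun σ => ?_
  simp only [AddMonoidHom.comp_apply, AddMonoidHom.sub_apply, AddMonoidHom.id_apply,
    ← affineChain_vertex σ]
  rw [subdivideHomotopy_affineChain, d_affineChain, subdivide_affineChain, bd_sdHomotopy,
    d_affineChain, subdivideHomotopy_affineChain, map_sub, map_sub]

end Subdivision

section Small

variable {X : TopCat.{u}}

/-- The subgroup of chains made of simplices that lie in a member of `𝒰`. -/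
def smallChains (𝒰 : Set (Set X)) (n : ℕ) : AddSubgroup ((singChains X).X n) :=
  AddSubgroup.closure
    {c | ∃ σ : C(TopSimplex n, X), (∃ W ∈ 𝒰, Set.range σ ⊆ W) ∧ simplexChain σ = c}

theorem closure_range_simplexChain (X : TopCat.{u}) (n : ℕ) :
    AddSubgroup.closure (Set.range (simplexChain : C(TopSimplex n, X) → _)) = ⊤ := by
  have h := (simplexBasis X n).span_eq
  rw [eq_top_iff]
  intro c _
  have hc : c ∈ Submodule.span ℤ (Set.range (simplexBasis X n)) := h ▸ Submodule.mem_top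
  rw [show (⇑(simplexBasis X n) : C(TopSimplex n, X) → _) = simplexChain from
    funext simplexBasis_apply] at hc
  rwa [← AddSubgroup.toIntSubmodule_closure] at hc

variable {𝒰 : Set (Set X)}

theorem affineChain_mem_smallChains {m : ℕ} {σ : C(TopSimplex m, X)}
    (hσ : ∃ W ∈ 𝒰, Set.range σ ⊆ W) (n : ℕ) (c : (Fin (n + 1) → TopSimplex m) →₀ ℤ) :
    affineChain σ n c ∈ smallChains 𝒰 n := by
  obtain ⟨W, hW, hσ⟩ := hσ
  refine map_mem_of_supported (S := Set.univ) (N := AddSubgroup.toIntSubmodule (smallChains 𝒰 n))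
    _ (fun v _ => ?_) (by simp)
  rw [affineChain_single]
  refine AddSubgroup.subset_closure ⟨_, ⟨W, hW, ?_⟩, rfl⟩
  rintro _ ⟨t, rfl⟩
  exact hσ ⟨_, rfl⟩

theorem subdivide_mem_smallChains {n : ℕ} {c : (singChains X).X n} (hc : c ∈ smallChains 𝒰 n) :
    subdivide X n c ∈ smallChains 𝒰 n := by
  suffices smallChains 𝒰 n ≤ (smallChains 𝒰 n).comap (subdivide X n) from this hc
  refine (AddSubgroup.closure_le _).2 ?_
  rintro _ ⟨σ, hσ, rfl⟩
  change subdivide X n (simplexChain σ) ∈ smallChains 𝒰 n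
  rw [← affineChain_vertex, subdivide_affineChain]
  exact affineChain_mem_smallChains hσ _ _

theorem subdivideHomotopy_mem_smallChains {n : ℕ} {c : (singChains X).X n}
    (hc : c ∈ smallChains 𝒰 n) : subdivideHomotopy X n c ∈ smallChains 𝒰 (n + 1) := by
  suffices smallChains 𝒰 n ≤ (smallChains 𝒰 (n + 1)).comap (subdivideHomotopy X n) from this hc
  refine (AddSubgroup.closure_le _).2 ?_
  rintro _ ⟨σ, hσ, rfl⟩
  change subdivideHomotopy X n (simplexChain σ) ∈ smallChains 𝒰 (n + 1)
  rw [← affineChain_vertex, subdivideHomotopy_affineChain]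
  exact affineChain_mem_smallChains hσ _ _

theorem iterate_subdivide_mem_smallChains {n : ℕ} {c : (singChains X).X n}
    (hc : c ∈ smallChains 𝒰 n) (m : ℕ) : (subdivide X n)^[m] c ∈ smallChains 𝒰 n := by
  induction m with
  | zero => exact hc
  | succ m ih => rw [Function.iterate_succ_apply']; exact subdivide_mem_smallChains ih

theorem iterate_subdivide_affineChain {m : ℕ} (σ : C(TopSimplex m, X)) (n k : ℕ)
    (c : (Fin (n + 1) → TopSimplex m) →₀ ℤ) :
    (subdivide X n)^[k] (affineChain σ n c) =
      affineChain σ n ((sd tupleBarycenter (n + 1))^[k] c) := by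
  induction k with
  | zero => rfl
  | succ k ih => rw [Function.iterate_succ_apply', Function.iterate_succ_apply', ih,
      subdivide_affineChain]

/-- Every simplex becomes small after finitely many subdivisions, by the Lebesgue number lemma. -/
theorem exists_iterate_subdivide_simplexChain_mem (h𝒰 : ∀ W ∈ 𝒰, IsOpen W) (hcov : ⋃₀ 𝒰 = Set.univ)
    {n : ℕ} (σ : C(TopSimplex n, X)) :
    ∃ m, (subdivide X n)^[m] (simplexChain σ) ∈ smallChains 𝒰 n := by
  obtain ⟨δ, hδ, hball⟩ := lebesgue_number_lemma_of_metric_sUnion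
    (s := (Set.univ : Set (TopSimplex n))) (c := (fun W => σ ⁻¹' W) '' 𝒰) isCompact_univ
    (by rintro _ ⟨W, hW, rfl⟩; exact (h𝒰 W hW).preimage σ.continuous) (by
      intro t _
      obtain ⟨W, hW, ht⟩ : σ t ∈ ⋃₀ 𝒰 := hcov ▸ Set.mem_univ _
      exact ⟨_, ⟨W, hW, rfl⟩, ht⟩)
  obtain ⟨m, hm⟩ := exists_pow_lt_of_lt_one (y := (n / (n + 1) : ℝ)) (x := δ) hδ
    ((div_lt_one (by positivity)).2 (by linarith))
  refine ⟨m, ?_⟩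
  rw [← affineChain_vertex, iterate_subdivide_affineChain]
  refine map_mem_of_supported (N := AddSubgroup.toIntSubmodule (smallChains 𝒰 n))
    _ (fun w hw => ?_) (iterate_sd_mem_supported dist_tupleBarycenter_le n m zero_le_one
      (Finsupp.single_mem_supported ℤ 1 fun i j => ?_))
  · obtain ⟨_, ⟨W, hW, rfl⟩, hsub⟩ := hball (w 0) (Set.mem_univ _)
    rw [affineChain_single]
    refine AddSubgroup.subset_closure ⟨_, ⟨W, hW, ?_⟩, rfl⟩
    rintro _ ⟨t, rfl⟩
    refine hsub ?_
    rw [Metric.mem_ball, dist_comm]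
    refine lt_of_le_of_lt ((dist_affineSimplex_le w t (w 0)).trans
      (Finset.sum_le_sum fun i _ => mul_le_mul_of_nonneg_left (hw 0 i) (stdSimplex.zero_le t i))) ?_
    rw [← Finset.sum_mul, mul_one, show ∑ i, t i = 1 from stdSimplex.sum_eq_one t, one_mul]
    exact hm
  · exact (Metric.dist_le_diam_of_mem (bounded_stdSimplex _) (stdSimplex.vertex i).2
      (stdSimplex.vertex j).2).trans diam_stdSimplex_le

theorem exists_iterate_subdivide_mem (h𝒰 : ∀ W ∈ 𝒰, IsOpen W) (hcov : ⋃₀ 𝒰 = Set.univ)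
    {n : ℕ} (c : (singChains X).X n) : ∃ m, (subdivide X n)^[m] c ∈ smallChains 𝒰 n := by
  have hc : c ∈ AddSubgroup.closure (Set.range (simplexChain : C(TopSimplex n, X) → _)) := by
    rw [closure_range_simplexChain]; trivial
  have hadd : ∀ m (x y : (singChains X).X n),
      (subdivide X n)^[m] (x + y) = (subdivide X n)^[m] x + (subdivide X n)^[m] y :=
    fun m x y => iterate_map_add _ m x y
  induction hc using AddSubgroup.closure_induction with
  | mem x hx =>
    obtain ⟨σ, rfl⟩ := hx
    exact exists_iterate_subdivide_simplexChain_mem h𝒰 hcov σ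
  | zero => exact ⟨0, zero_mem _⟩
  | add x y _ _ hx hy =>
    obtain ⟨a, ha⟩ := hx
    obtain ⟨b, hb⟩ := hy
    refine ⟨a + b, ?_⟩
    rw [hadd]
    refine add_mem ?_ ?_
    · rw [add_comm, Function.iterate_add_apply]
      exact iterate_subdivide_mem_smallChains ha b
    · rw [Function.iterate_add_apply]
      exact iterate_subdivide_mem_smallChains hb a
  | neg x _ hx =>
    obtain ⟨a, ha⟩ := hx
    refine ⟨a, ?_⟩
    rw [iterate_map_neg]
    exact neg_mem ha

/-- The small chains theorem. In degree `0` the condition is void, as `d 0 0 = 0`. -/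
theorem exists_sub_d_mem_smallChains (h𝒰 : ∀ W ∈ 𝒰, IsOpen W) (hcov : ⋃₀ 𝒰 = Set.univ)
    (n : ℕ) (c : (singChains X).X n)
    (hc : ((singChains X).d n (n - 1)).hom c ∈ smallChains 𝒰 (n - 1)) :
    ∃ b, c - ((singChains X).d (n + 1) n).hom b ∈ smallChains 𝒰 n := by
  have step : ∀ c : (singChains X).X n,
      ((singChains X).d n (n - 1)).hom c ∈ smallChains 𝒰 (n - 1) →
      c - subdivide X n c - ((singChains X).d (n + 1) n).hom (subdivideHomotopy X n c) ∈
        smallChains 𝒰 n ∧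
      ((singChains X).d n (n - 1)).hom (subdivide X n c) ∈ smallChains 𝒰 (n - 1) := by
    intro c hc
    cases n with
    | zero =>
      refine ⟨?_, ?_⟩
      · rw [d_subdivideHomotopy_zero, sub_self]; exact zero_mem _
      · rw [(singChains X).shape _ _ (by simp)]; exact zero_mem _
    | succ n =>
      refine ⟨?_, ?_⟩
      · rw [d_subdivideHomotopy, sub_sub_cancel]
        exact subdivideHomotopy_mem_smallChains hc
      · have := subdivide_mem_smallChains hc
        rwa [show n + 1 - 1 = n from rfl, ← d_subdivide] at this
  have iter : ∀ m, ∃ b, c - (subdivide X n)^[m] c - ((singChains X).d (n + 1) n).hom b ∈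
        smallChains 𝒰 n ∧
      ((singChains X).d n (n - 1)).hom ((subdivide X n)^[m] c) ∈ smallChains 𝒰 (n - 1) := by
    intro m
    induction m with
    | zero => exact ⟨0, by simp, hc⟩
    | succ m ih =>
      obtain ⟨b, hb, hd⟩ := ih
      obtain ⟨h₁, h₂⟩ := step _ hd
      refine ⟨b + subdivideHomotopy X n ((subdivide X n)^[m] c), ?_, ?_⟩
      · rw [Function.iterate_succ_apply', map_add]
        convert add_mem hb h₁ using 1
        abel
      · rw [Function.iterate_succ_apply']; exact h₂
  obtain ⟨m, hm⟩ := exists_iterate_subdivide_mem h𝒰 hcov c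
  obtain ⟨b, hb, -⟩ := iter m
  refine ⟨b, ?_⟩
  convert add_mem hb hm using 1
  abel

end Small

end

/-! ### Chains of an open cover -/

section

open Limits HomologicalComplex

namespace ChainComplexAb

variable {K L : ChainComplex AddCommGrpCat.{u} ℕ} (f : K ⟶ L)

theorem homologyπ_surjective (n : ℕ) : Function.Surjective (K.homologyπ n).hom :=
  (AddCommGrpCat.epi_iff_surjective _).1 inferInstance

theorem iCycles_injective (n : ℕ) : Function.Injective (K.iCycles n).hom :=
  (AddCommGrpCat.mono_iff_injective _).1 inferInstance

theorem d_iCycles (n m : ℕ) (w : K.cycles n) :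
    (K.d n m).hom ((K.iCycles n).hom w) = 0 :=
  congrArg (fun φ => φ.hom w) (K.iCycles_d n m)

theorem exists_cycle (n : ℕ) (z : K.X n) (hz : (K.d n (n - 1)).hom z = 0) :
    ∃ w, (K.iCycles n).hom w = z :=
  (ShortComplex.ab_exact_iff _).1 (ShortComplex.exact_of_f_is_kernel
    (.mk _ _ (K.iCycles_d n (n - 1))) (K.cyclesIsKernel n (n - 1) (by cases n <;> simp))) z hz

theorem homologyπ_eq_zero_iff (n : ℕ) (w : K.cycles n) :
    (K.homologyπ n).hom w = 0 ↔ ∃ c, (K.d (n + 1) n).hom c = (K.iCycles n).hom w := by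
  have h := (ShortComplex.ab_exact_iff _).1 (ShortComplex.exact_of_g_is_cokernel
    (.mk _ _ (K.toCycles_comp_homologyπ (n + 1) n)) (K.homologyIsCokernel (n + 1) n (by simp)))
  have e : ∀ c, (K.iCycles n).hom ((K.toCycles (n + 1) n).hom c) = (K.d (n + 1) n).hom c :=
    fun c => congrArg (fun φ => φ.hom c) (K.toCycles_i (n + 1) n)
  constructor
  · intro hw
    obtain ⟨c, hc⟩ := h w hw
    exact ⟨c, by rw [← e]; exact congrArg _ hc⟩
  · rintro ⟨c, hc⟩
    rw [← e] at hc
    rw [← iCycles_injective n hc]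
    exact congrArg (fun φ => φ.hom c) (K.toCycles_comp_homologyπ (n + 1) n)

theorem homologyMap_homologyπ (n : ℕ) (w : K.cycles n) :
    (homologyMap f n).hom ((K.homologyπ n).hom w) =
      (L.homologyπ n).hom ((cyclesMap f n).hom w) :=
  congrArg (fun φ => φ.hom w) (homologyπ_naturality f n)

theorem iCycles_cyclesMap (n : ℕ) (w : K.cycles n) :
    (L.iCycles n).hom ((cyclesMap f n).hom w) = (f.f n).hom ((K.iCycles n).hom w) :=
  congrArg (fun φ => φ.hom w) (cyclesMap_i f n)

theorem d_map (n m : ℕ) (c : K.X n) :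
    (L.d n m).hom ((f.f n).hom c) = (f.f m).hom ((K.d n m).hom c) :=
  congrArg (fun φ => φ.hom c) (f.comm n m)

variable {f}

/-- An injective chain map `K → L` is a quasi-isomorphism if every chain of `L` with boundary in `K`
can be moved into `K` by a boundary. -/
theorem homologyMap_bijective (hinj : ∀ n, Function.Injective (f.f n).hom)
    (h : ∀ n (c : L.X n), (L.d n (n - 1)).hom c ∈ (f.f (n - 1)).hom.range →
      ∃ b, c - (L.d (n + 1) n).hom b ∈ (f.f n).hom.range) (n : ℕ) :
    Function.Bijective (homologyMap f n).hom := by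
  constructor
  · rw [injective_iff_map_eq_zero]
    intro x hx
    obtain ⟨w, rfl⟩ := homologyπ_surjective n x
    rw [homologyMap_homologyπ, homologyπ_eq_zero_iff] at hx
    obtain ⟨c, hc⟩ := hx
    rw [iCycles_cyclesMap] at hc
    obtain ⟨b, q, hq⟩ := h (n + 1) c ⟨_, hc.symm⟩
    refine (homologyπ_eq_zero_iff n w).2 ⟨q, hinj n ?_⟩
    rw [← d_map, hq, map_sub, hc]
    exact sub_eq_self.2 (congrArg (fun φ => φ.hom b) (L.d_comp_d (n + 1 + 1) (n + 1) n))
  · intro y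
    obtain ⟨w, rfl⟩ := homologyπ_surjective n y
    obtain ⟨b, q, hq⟩ := h n ((L.iCycles n).hom w) (by rw [d_iCycles]; exact zero_mem _)
    have hdq : (K.d n (n - 1)).hom q = 0 := by
      refine hinj (n - 1) ?_
      rw [← d_map, hq, map_sub, d_iCycles, map_zero, zero_sub, neg_eq_zero]
      exact congrArg (fun φ => φ.hom b) (L.d_comp_d (n + 1) n (n - 1))
    obtain ⟨v, rfl⟩ := exists_cycle n q hdq
    refine ⟨(K.homologyπ n).hom v, ?_⟩
    rw [homologyMap_homologyπ, ← sub_eq_zero, ← map_sub, homologyπ_eq_zero_iff]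
    refine ⟨-b, ?_⟩
    rw [map_neg, map_sub, iCycles_cyclesMap, hq]
    abel

end ChainComplexAb

section Embeddings

variable {X Y : TopCat.{u}}

theorem simplexBasis_repr_map (g : X ⟶ Y) (n : ℕ) (c : (singChains X).X n) :
    (simplexBasis Y n).repr (((singChainsMap g).f n).hom c) =
      Finsupp.mapDomain g.hom.comp ((simplexBasis X n).repr c) := by
  suffices (simplexBasis Y n).repr.toLinearMap ∘ₗ ((singChainsMap g).f n).hom.toIntLinearMap =
      Finsupp.lmapDomain ℤ ℤ g.hom.comp ∘ₗ (simplexBasis X n).repr.toLinearMap from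
    LinearMap.congr_fun this c
  refine (simplexBasis X n).ext fun σ => ?_
  simp only [LinearMap.comp_apply, LinearEquiv.coe_coe, Module.Basis.repr_self,
    Finsupp.lmapDomain_apply, Finsupp.mapDomain_single]
  rw [simplexBasis_apply]
  refine (congrArg (simplexBasis Y n).repr (singChainsMap_simplexChain g σ)).trans ?_
  rw [← simplexBasis_apply, Module.Basis.repr_self]

theorem comp_injective (g : X ⟶ Y) (hg : Function.Injective g) (n : ℕ) :
    Function.Injective (g.hom.comp : C(TopSimplex n, X) → C(TopSimplex n, Y)) :=
  fun _ _ h => ContinuousMap.ext fun t => hg (DFunLike.congr_fun h t)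

theorem singChainsMap_injective (g : X ⟶ Y) (hg : Function.Injective g) (n : ℕ) :
    Function.Injective ((singChainsMap g).f n).hom := by
  intro c c' h
  refine (simplexBasis X n).repr.injective
    (Finsupp.mapDomain_injective (comp_injective g hg n) ?_)
  rw [← simplexBasis_repr_map, ← simplexBasis_repr_map]
  exact congrArg _ h

theorem exists_comp_eq {g : X ⟶ Y} (hg : Topology.IsEmbedding g) {n : ℕ} {τ : C(TopSimplex n, Y)}
    (h : Set.range τ ⊆ Set.range g) : ∃ σ : C(TopSimplex n, X), g.hom.comp σ = τ := by
  choose s hs using fun t => h ⟨t, rfl⟩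
  have hgs : g ∘ s = τ := funext hs
  exact ⟨⟨s, hg.continuous_iff.2 (hgs ▸ τ.continuous)⟩, ContinuousMap.ext hs⟩

open Classical in
/-- The chains that come from a subspace are those whose simplices lie in it. -/
theorem mem_range_singChainsMap_iff {g : X ⟶ Y} (hg : Topology.IsEmbedding g) {n : ℕ}
    (c : (singChains Y).X n) : c ∈ ((singChainsMap g).f n).hom.range ↔
      ∀ τ ∈ ((simplexBasis Y n).repr c).support, Set.range τ ⊆ Set.range g := by
  constructor
  · rintro ⟨c, rfl⟩ τ hτ
    rw [simplexBasis_repr_map] at hτ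
    obtain ⟨σ, -, rfl⟩ := Finset.mem_image.1 (Finsupp.mapDomain_support hτ)
    rintro _ ⟨t, rfl⟩
    exact ⟨_, rfl⟩
  · intro h
    obtain ⟨c', hc'⟩ := (Finsupp.mem_range_mapDomain_iff _ (comp_injective g hg.injective n)
      ((simplexBasis Y n).repr c)).2 fun τ hτ => by
        by_contra hne
        exact hτ (exists_comp_eq hg (h τ (Finsupp.mem_support_iff.2 hne)))
    refine ⟨(simplexBasis X n).repr.symm c', (simplexBasis Y n).repr.injective ?_⟩
    rw [simplexBasis_repr_map, LinearEquiv.apply_symm_apply, hc']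

end Embeddings

/-- A commutative square of spaces in which `i` and `j` are the inclusions of two open subspaces
that cover `X`, and `A` is their intersection. -/
structure OpenCoverSquare {A U V X : TopCat.{u}} (a : A ⟶ U) (b : A ⟶ V) (i : U ⟶ X) (j : V ⟶ X) :
    Prop where
  comm : a ≫ i = b ≫ j
  isEmbedding : Topology.IsEmbedding a
  isOpenEmbedding_left : Topology.IsOpenEmbedding i
  isOpenEmbedding_right : Topology.IsOpenEmbedding j
  cover : ∀ x, x ∈ Set.range i ∨ x ∈ Set.range j
  exists_of_eq : ∀ x y, i x = j y → ∃ z, a z = x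

namespace OpenCoverSquare

variable {A U V X : TopCat.{u}} {a : A ⟶ U} {b : A ⟶ V} {i : U ⟶ X} {j : V ⟶ X}

theorem singChainsMap_comm (h : OpenCoverSquare a b i j) :
    singChainsMap a ≫ singChainsMap i = singChainsMap b ≫ singChainsMap j := by
  have := congrArg (((singularChainComplexFunctor AddCommGrpCat.{u}).obj
    (AddCommGrpCat.of (ULift.{u} ℤ))).map) h.comm
  rw [Functor.map_comp, Functor.map_comp] at this
  exact this

theorem singChainsMap_comm_apply (h : OpenCoverSquare a b i j) (n : ℕ) (c : (singChains A).X n) :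
    ((singChainsMap i).f n).hom (((singChainsMap a).f n).hom c) =
      ((singChainsMap j).f n).hom (((singChainsMap b).f n).hom c) :=
  congrArg (fun φ => (φ.f n).hom c) h.singChainsMap_comm

theorem exists_chain (h : OpenCoverSquare a b i j) (n : ℕ) (x : (singChains U).X n)
    (y : (singChains V).X n)
    (hxy : ((singChainsMap i).f n).hom x = ((singChainsMap j).f n).hom y) :
    ∃ z, ((singChainsMap a).f n).hom z = x ∧ ((singChainsMap b).f n).hom z = y := by
  have hx : x ∈ ((singChainsMap a).f n).hom.range := by
    rw [mem_range_singChainsMap_iff h.isEmbedding]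
    rintro σ hσ _ ⟨t, rfl⟩
    have hi := comp_injective i h.isOpenEmbedding_left.injective n
    have hy := (mem_range_singChainsMap_iff h.isOpenEmbedding_right.isEmbedding _).1
      ⟨y, hxy.symm⟩ (i.hom.comp σ) (by
        rw [Finsupp.mem_support_iff, simplexBasis_repr_map, Finsupp.mapDomain_apply hi]
        exact Finsupp.mem_support_iff.1 hσ)
    obtain ⟨v, hv⟩ := hy ⟨t, rfl⟩
    exact h.exists_of_eq _ _ hv.symm
  obtain ⟨z, rfl⟩ := hx
  refine ⟨z, rfl, singChainsMap_injective j h.isOpenEmbedding_right.injective n ?_⟩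
  rw [← hxy, singChainsMap_comm_apply h]

theorem mem_smallChains_iff (h : OpenCoverSquare a b i j) (n : ℕ)
    (c : (singChains X).X n) : c ∈ smallChains {Set.range i, Set.range j} n ↔
      ∃ x y, c = ((singChainsMap i).f n).hom x + ((singChainsMap j).f n).hom y := by
  constructor
  · intro hc
    have hle : smallChains {Set.range i, Set.range j} n ≤
        ((singChainsMap i).f n).hom.range ⊔ ((singChainsMap j).f n).hom.range := by
      refine (AddSubgroup.closure_le _).2 ?_
      rintro _ ⟨τ, ⟨W, rfl | rfl, hτ⟩, rfl⟩
      · obtain ⟨σ, rfl⟩ := exists_comp_eq h.isOpenEmbedding_left.isEmbedding hτ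
        exact AddSubgroup.mem_sup_left ⟨simplexChain σ, singChainsMap_simplexChain _ _⟩
      · obtain ⟨σ, rfl⟩ := exists_comp_eq h.isOpenEmbedding_right.isEmbedding hτ
        exact AddSubgroup.mem_sup_right ⟨simplexChain σ, singChainsMap_simplexChain _ _⟩
    obtain ⟨_, ⟨x, rfl⟩, _, ⟨y, rfl⟩, rfl⟩ := AddSubgroup.mem_sup.1 (hle hc)
    exact ⟨x, y, rfl⟩
  · rintro ⟨x, y, rfl⟩
    have key : ∀ {W : TopCat.{u}} (k : W ⟶ X),
        Set.range k ∈ ({Set.range i, Set.range j} : Set (Set X)) →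
        ∀ x, ((singChainsMap k).f n).hom x ∈ smallChains {Set.range i, Set.range j} n := by
      intro W k hk x
      have hx : x ∈ AddSubgroup.closure (Set.range (simplexChain : C(TopSimplex n, W) → _)) := by
        rw [closure_range_simplexChain]; trivial
      suffices AddSubgroup.closure (Set.range (simplexChain : C(TopSimplex n, W) → _)) ≤
        (smallChains {Set.range i, Set.range j} n).comap ((singChainsMap k).f n).hom from this hx
      refine (AddSubgroup.closure_le _).2 ?_
      rintro _ ⟨σ, rfl⟩
      refine AddSubgroup.subset_closure ⟨k.hom.comp σ, ⟨_, hk, ?_⟩,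
        (singChainsMap_simplexChain k σ).symm⟩
      rintro _ ⟨t, rfl⟩
      exact ⟨_, rfl⟩
    exact add_mem (key i (by simp) x) (key j (by simp) y)

theorem exists_sub_d (h : OpenCoverSquare a b i j) (n : ℕ) (c : (singChains X).X n)
    (hc : ∃ x y, ((singChains X).d n (n - 1)).hom c =
      ((singChainsMap i).f (n - 1)).hom x + ((singChainsMap j).f (n - 1)).hom y) :
    ∃ e x y, c - ((singChains X).d (n + 1) n).hom e =
      ((singChainsMap i).f n).hom x + ((singChainsMap j).f n).hom y := by
  rw [← mem_smallChains_iff h] at hc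
  obtain ⟨e, he⟩ := exists_sub_d_mem_smallChains (by
    rintro W (rfl | rfl)
    exacts [h.isOpenEmbedding_left.isOpen_range, h.isOpenEmbedding_right.isOpen_range]) (by
    ext x
    simpa using h.cover x) n c hc
  exact ⟨e, (mem_smallChains_iff h n _).1 he⟩

end OpenCoverSquare

end

/-! ### The Mayer-Vietoris sequence -/

section

open Limits HomologicalComplex

/-- The homomorphism on homology induced by a chain map. -/
abbrev inducedHom {K L : ChainComplex AddCommGrpCat.{u} ℕ} (f : K ⟶ L) (n : ℕ) :
    K.homology n →+ L.homology n :=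
  (homologyMap f n).hom

section inducedHom

variable {K L M : ChainComplex AddCommGrpCat.{u} ℕ} (f g : K ⟶ L) (n : ℕ) (x : K.homology n)

theorem inducedHom_comp (g : L ⟶ M) :
    inducedHom (f ≫ g) n x = inducedHom g n (inducedHom f n x) :=
  congrArg (fun φ => φ.hom x) (homologyMap_comp f g n)

theorem inducedHom_id : inducedHom (𝟙 K) n x = x :=
  congrArg (fun φ => φ.hom x) (homologyMap_id K n)

theorem inducedHom_zero : inducedHom (0 : K ⟶ L) n x = 0 :=
  congrArg (fun φ => φ.hom x) (homologyMap_zero K L n)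

theorem inducedHom_add : inducedHom (f + g) n x = inducedHom f n x + inducedHom g n x :=
  congrArg (fun φ => φ.hom x) (homologyMap_add f g n)

theorem inducedHom_sub : inducedHom (f - g) n x = inducedHom f n x - inducedHom g n x :=
  congrArg (fun φ => φ.hom x) (homologyMap_sub f g n)

end inducedHom

namespace OpenCoverSquare

variable {A U V X : TopCat.{u}} {a : A ⟶ U} {b : A ⟶ V} {i : U ⟶ X} {j : V ⟶ X}

/-- The map `C(U) ⊞ C(V) ⟶ C(X)` that sends `(x, y)` to `i x - j y`; its image `C(U) + C(V)`
consists of the chains that are small with respect to the cover. -/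
abbrev differenceMap (i : U ⟶ X) (j : V ⟶ X) : singChains U ⊞ singChains V ⟶ singChains X :=
  biprod.desc (singChainsMap i) (-singChainsMap j)

theorem comp_differenceMap (h : OpenCoverSquare a b i j) :
    biprod.lift (singChainsMap a) (singChainsMap b) ≫ factorThruImage (differenceMap i j) = 0 := by
  rw [← cancel_mono (image.ι (differenceMap i j)), Category.assoc, image.fac, zero_comp,
    biprod.lift_desc, Preadditive.comp_neg, h.singChainsMap_comm, add_neg_cancel]

/-- The short complex `C(A) ⟶ C(U) ⊞ C(V) ⟶ C(U) + C(V)`. -/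
def mayerVietorisComplex (h : OpenCoverSquare a b i j) :
    ShortComplex (ChainComplex AddCommGrpCat.{u} ℕ) :=
  .mk _ _ h.comp_differenceMap

theorem differenceMap_eq (i : U ⟶ X) (j : V ⟶ X) :
    differenceMap i j = biprod.fst ≫ singChainsMap i - biprod.snd ≫ singChainsMap j :=
  biprod.hom_ext' _ _ (by simp) (by simp)

theorem lift_eq (a : A ⟶ U) (b : A ⟶ V) :
    biprod.lift (singChainsMap a) (singChainsMap b) =
      singChainsMap a ≫ biprod.inl + singChainsMap b ≫ biprod.inr :=
  biprod.hom_ext _ _ (by simp) (by simp)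

theorem differenceMap_apply (i : U ⟶ X) (j : V ⟶ X) (n : ℕ)
    (w : (singChains U ⊞ singChains V).X n) :
    ((differenceMap i j).f n).hom w =
      ((singChainsMap i).f n).hom (((biprod.fst : singChains U ⊞ singChains V ⟶ _).f n).hom w) -
      ((singChainsMap j).f n).hom (((biprod.snd : singChains U ⊞ singChains V ⟶ _).f n).hom w) :=
  congrArg (fun φ => (φ.f n).hom w) (differenceMap_eq i j)

theorem mem_range_image_ι (i : U ⟶ X) (j : V ⟶ X) (n : ℕ) (c : (singChains X).X n) :
    c ∈ ((image.ι (differenceMap i j)).f n).hom.range ↔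
      ∃ x y, c = ((singChainsMap i).f n).hom x + ((singChainsMap j).f n).hom y := by
  have hfac : ∀ w, ((image.ι (differenceMap i j)).f n).hom
      (((factorThruImage (differenceMap i j)).f n).hom w) =
      ((differenceMap i j).f n).hom w :=
    fun w => congrArg (fun φ => (φ.f n).hom w) (image.fac (differenceMap i j))
  constructor
  · rintro ⟨q, rfl⟩
    obtain ⟨w, rfl⟩ := (AddCommGrpCat.epi_iff_surjective
      ((factorThruImage (differenceMap i j)).f n)).1 inferInstance q
    refine ⟨((biprod.fst : singChains U ⊞ singChains V ⟶ _).f n).hom w,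
      -((biprod.snd : singChains U ⊞ singChains V ⟶ _).f n).hom w, ?_⟩
    rw [map_neg, ← sub_eq_add_neg]
    exact (hfac w).trans (differenceMap_apply i j n w)
  · rintro ⟨x, y, rfl⟩
    refine ⟨((factorThruImage (differenceMap i j)).f n).hom
      (((biprod.inl : _ ⟶ singChains U ⊞ singChains V).f n).hom x -
        ((biprod.inr : _ ⟶ singChains U ⊞ singChains V).f n).hom y), ?_⟩
    rw [hfac, map_sub, sub_eq_add_neg, ← map_neg]
    congr 1
    · exact congrArg (fun φ => (φ.f n).hom x) (biprod.inl_desc (singChainsMap i) (-singChainsMap j))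
    · rw [map_neg]
      have := congrArg (fun φ => (φ.f n).hom y)
        (biprod.inr_desc (singChainsMap i) (-singChainsMap j))
      refine (congrArg Neg.neg this).trans (neg_neg _)

theorem bijective_homologyMap_image_ι (h : OpenCoverSquare a b i j) (n : ℕ) :
    Function.Bijective (inducedHom (image.ι (differenceMap i j)) n) := by
  refine ChainComplexAb.homologyMap_bijective (fun n => ?_) (fun n c hc => ?_) n
  · exact (AddCommGrpCat.mono_iff_injective _).1 inferInstance
  · rw [mem_range_image_ι] at hc
    obtain ⟨e, he⟩ := h.exists_sub_d n c hc
    exact ⟨e, (mem_range_image_ι i j n _).2 he⟩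

theorem shortExact_mayerVietorisComplex (h : OpenCoverSquare a b i j) :
    h.mayerVietorisComplex.ShortExact where
  exact := by
    refine exact_of_degreewise_exact _ fun n => ?_
    rw [ShortComplex.ab_exact_iff]
    intro (w : (singChains U ⊞ singChains V).X n) hw
    have hw' : ((differenceMap i j).f n).hom w = 0 := by
      rw [← image.fac (differenceMap i j)]
      exact (congrArg ((image.ι (differenceMap i j)).f n).hom hw).trans (map_zero _)
    rw [differenceMap_apply, sub_eq_zero] at hw'
    obtain ⟨z, hz₁, hz₂⟩ := h.exists_chain n _ _ hw'
    refine ⟨z, ?_⟩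
    have htot := congrArg (fun φ => (φ.f n).hom w)
      (biprod.total (X := singChains U) (Y := singChains V))
    refine (congrArg (fun φ => (φ.f n).hom z) (lift_eq a b)).trans (Eq.trans ?_ htot)
    change ((biprod.inl : _ ⟶ singChains U ⊞ singChains V).f n).hom
        (((singChainsMap a).f n).hom z) +
      ((biprod.inr : _ ⟶ singChains U ⊞ singChains V).f n).hom (((singChainsMap b).f n).hom z) = _
    rw [hz₁, hz₂]
    rfl
  mono_f := by
    refine mono_of_mono_f _ fun n => (AddCommGrpCat.mono_iff_injective _).2 fun x y hxy => ?_
    refine singChainsMap_injective a h.isEmbedding.injective n ?_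
    have : singChainsMap a = biprod.lift (singChainsMap a) (singChainsMap b) ≫ biprod.fst := by simp
    rw [this]
    exact congrArg ((biprod.fst : singChains U ⊞ singChains V ⟶ _).f n).hom hxy
  epi_g := inferInstanceAs (Epi (factorThruImage (differenceMap i j)))

theorem inducedHom_image_ι (n : ℕ) (w : (singChains U ⊞ singChains V).homology n) :
    inducedHom (image.ι (differenceMap i j)) n
        (inducedHom (factorThruImage (differenceMap i j)) n w) =
      inducedHom (singChainsMap i) n (inducedHom biprod.fst n w) -
        inducedHom (singChainsMap j) n (inducedHom biprod.snd n w) := by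
  rw [← inducedHom_comp, image.fac, differenceMap_eq, inducedHom_sub, inducedHom_comp,
    inducedHom_comp]

theorem inducedHom_fst_add (n : ℕ) (x : (singChains U).homology n) (y : (singChains V).homology n) :
    inducedHom (biprod.fst : singChains U ⊞ singChains V ⟶ _) n
      (inducedHom biprod.inl n x + inducedHom biprod.inr n y) = x := by
  rw [map_add, ← inducedHom_comp, ← inducedHom_comp, biprod.inl_fst, biprod.inr_fst, inducedHom_id,
    inducedHom_zero, add_zero]

theorem inducedHom_snd_add (n : ℕ) (x : (singChains U).homology n) (y : (singChains V).homology n) :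
    inducedHom (biprod.snd : singChains U ⊞ singChains V ⟶ _) n
      (inducedHom biprod.inl n x + inducedHom biprod.inr n y) = y := by
  rw [map_add, ← inducedHom_comp, ← inducedHom_comp, biprod.inl_snd, biprod.inr_snd, inducedHom_id,
    inducedHom_zero, zero_add]

/-- Exactness of the Mayer-Vietoris sequence at `H_n(U) ⊕ H_n(V)`. -/
theorem exists_homology_of_eq (h : OpenCoverSquare a b i j) (n : ℕ) (x : (singChains U).homology n)
    (y : (singChains V).homology n)
    (hxy : inducedHom (singChainsMap i) n x = inducedHom (singChainsMap j) n y) :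
    ∃ z, inducedHom (singChainsMap a) n z = x ∧ inducedHom (singChainsMap b) n z = y := by
  let w : (singChains U ⊞ singChains V).homology n :=
    inducedHom biprod.inl n x + inducedHom biprod.inr n y
  have hw : inducedHom (factorThruImage (differenceMap i j)) n w = 0 := by
    refine (h.bijective_homologyMap_image_ι n).1 ?_
    rw [inducedHom_image_ι, map_zero, inducedHom_fst_add, inducedHom_snd_add, hxy, sub_self]
  have hex : Function.Exact (inducedHom (biprod.lift (singChainsMap a) (singChainsMap b)) n)
      (inducedHom (factorThruImage (differenceMap i j)) n) :=
    (ShortComplex.ab_exact_iff_function_exact _).1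
      (h.shortExact_mayerVietorisComplex.homology_exact₂ n)
  obtain ⟨z, hz⟩ := (hex w).1 hw
  refine ⟨z, ?_, ?_⟩
  · rw [← inducedHom_fst_add n x y]
    refine Eq.trans ?_ (congrArg (inducedHom biprod.fst n) hz)
    rw [← inducedHom_comp, biprod.lift_fst]
  · rw [← inducedHom_snd_add n x y]
    refine Eq.trans ?_ (congrArg (inducedHom biprod.snd n) hz)
    rw [← inducedHom_comp, biprod.lift_snd]

/-- The connecting homomorphism of the Mayer-Vietoris sequence, with exactness at both ends. -/
theorem exists_connecting (h : OpenCoverSquare a b i j) (n : ℕ) :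
    ∃ δ : (singChains X).homology (n + 1) →+ (singChains A).homology n,
      (∀ x, δ x = 0 ↔ ∃ u v,
        x = inducedHom (singChainsMap i) (n + 1) u + inducedHom (singChainsMap j) (n + 1) v) ∧
      (∀ z, (∃ x, δ x = z) ↔
        inducedHom (singChainsMap a) n z = 0 ∧ inducedHom (singChainsMap b) n z = 0) := by
  let e := AddEquiv.ofBijective _ (h.bijective_homologyMap_image_ι (n + 1))
  have hS := h.shortExact_mayerVietorisComplex
  let d : (image (differenceMap i j)).homology (n + 1) →+ (singChains A).homology n :=
    (hS.δ (n + 1) n (by simp)).hom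
  have h₃ : Function.Exact (inducedHom (factorThruImage (differenceMap i j)) (n + 1)) d :=
    (ShortComplex.ab_exact_iff_function_exact _).1 (hS.homology_exact₃ (n + 1) n (by simp))
  have h₁ : Function.Exact d (inducedHom (biprod.lift (singChainsMap a) (singChainsMap b)) n) :=
    (ShortComplex.ab_exact_iff_function_exact _).1 (hS.homology_exact₁ (n + 1) n (by simp))
  have hfac : ∀ w, e (inducedHom (factorThruImage (differenceMap i j)) (n + 1) w) =
      inducedHom (singChainsMap i) (n + 1) (inducedHom biprod.fst (n + 1) w) -
        inducedHom (singChainsMap j) (n + 1) (inducedHom biprod.snd (n + 1) w) :=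
    fun w => inducedHom_image_ι (n + 1) w
  let e' : (singChains X).homology (n + 1) →+ (image (differenceMap i j)).homology (n + 1) :=
    e.symm.toAddMonoidHom
  have he : ∀ x, e (e' x) = x := e.apply_symm_apply
  have he' : ∀ x, e' (e x) = x := e.symm_apply_apply
  refine ⟨d.comp e', fun x => ?_, fun z => ?_⟩
  · refine (h₃ (e' x)).trans ⟨?_, ?_⟩
    · rintro ⟨w, hw⟩
      refine ⟨inducedHom biprod.fst (n + 1) w, -inducedHom biprod.snd (n + 1) w, ?_⟩
      rw [← he x, ← hw, hfac, map_neg, sub_eq_add_neg]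
    · rintro ⟨u, v, rfl⟩
      refine ⟨inducedHom biprod.inl (n + 1) u + inducedHom biprod.inr (n + 1) (-v),
        e.injective ?_⟩
      rw [hfac, he, inducedHom_fst_add, inducedHom_snd_add, map_neg, sub_neg_eq_add]
  · have hd : (∃ x, d.comp e' x = z) ↔ ∃ y, d y = z :=
      ⟨fun ⟨x, hx⟩ => ⟨_, hx⟩, fun ⟨y, hy⟩ => ⟨e y, by
        rw [AddMonoidHom.comp_apply, he', hy]⟩⟩
    rw [hd]
    refine (h₁ z).symm.trans ⟨fun hz => ⟨?_, ?_⟩, ?_⟩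
    · have := congrArg (inducedHom (biprod.fst : singChains U ⊞ singChains V ⟶ _) n) hz
      rwa [← inducedHom_comp, biprod.lift_fst, map_zero] at this
    · have := congrArg (inducedHom (biprod.snd : singChains U ⊞ singChains V ⟶ _) n) hz
      rwa [← inducedHom_comp, biprod.lift_snd, map_zero] at this
    · rintro ⟨hz₁, hz₂⟩
      rw [lift_eq, inducedHom_add, inducedHom_comp, inducedHom_comp]
      rw [hz₁, hz₂, map_zero, map_zero, add_zero]

/-- In degree `0` every class comes from `U` and `V`. -/
theorem exists_add_degree_zero (h : OpenCoverSquare a b i j) (x : (singChains X).homology 0) :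
    ∃ u v, x = inducedHom (singChainsMap i) 0 u + inducedHom (singChainsMap j) 0 v := by
  obtain ⟨y, rfl⟩ := (h.bijective_homologyMap_image_ι 0).2 x
  have : Epi (homologyMap (factorThruImage (differenceMap i j)) 0) :=
    epi_homologyMap_of_epi_of_not_rel _ _ (by simp)
  obtain ⟨w, rfl⟩ := (AddCommGrpCat.epi_iff_surjective _).1 this y
  refine ⟨inducedHom biprod.fst 0 w, -inducedHom biprod.snd 0 w, ?_⟩
  rw [map_neg, ← sub_eq_add_neg]
  exact inducedHom_image_ι 0 w

/-- The Mayer-Vietoris sequence of singular homology. -/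
theorem mayerVietoris (h : OpenCoverSquare a b i j) (n : ℕ) :
    ∃ δ : IntHomology (n + 1) X →+ IntHomology n A,
      (∀ x, δ x = 0 ↔ ∃ u v, x = intHomologyMap (n + 1) i u + intHomologyMap (n + 1) j v) ∧
      (∀ z, (∃ x, δ x = z) ↔ intHomologyMap n a z = 0 ∧ intHomologyMap n b z = 0) :=
  h.exists_connecting n

/-- Exactness of the Mayer-Vietoris sequence at the direct sum. -/
theorem mayerVietoris_middle (h : OpenCoverSquare a b i j) (n : ℕ) {x : IntHomology n U}
    {y : IntHomology n V} (hxy : intHomologyMap n i x = intHomologyMap n j y) :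
    ∃ z, intHomologyMap n a z = x ∧ intHomologyMap n b z = y :=
  h.exists_homology_of_eq n x y hxy

/-- The right end of the Mayer-Vietoris sequence. -/
theorem mayerVietoris_zero (h : OpenCoverSquare a b i j) (x : IntHomology 0 X) :
    ∃ u v, x = intHomologyMap 0 i u + intHomologyMap 0 j v :=
  h.exists_add_degree_zero x

end OpenCoverSquare

end

/-! ### Acyclic spaces and homology spheres -/

section

section Functoriality

variable {X Y Z : TopCat.{u}}

theorem intHomologyMap_comp (k : ℕ) (f : X ⟶ Y) (g : Y ⟶ Z) (x : IntHomology k X) :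
    intHomologyMap k (f ≫ g) x = intHomologyMap k g (intHomologyMap k f x) :=
  congrArg (fun φ => φ.hom x) (((singularHomologyFunctor AddCommGrpCat.{u} k).obj
    (AddCommGrpCat.of (ULift.{u} ℤ))).map_comp f g)

theorem intHomologyMap_id (k : ℕ) (x : IntHomology k X) : intHomologyMap k (𝟙 X) x = x :=
  congrArg (fun φ => φ.hom x) (((singularHomologyFunctor AddCommGrpCat.{u} k).obj
    (AddCommGrpCat.of (ULift.{u} ℤ))).map_id X)

theorem intHomologyMap_eq_of_homotopic (k : ℕ) {f g : X ⟶ Y} (h : f.hom.Homotopic g.hom) :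
    intHomologyMap k f = intHomologyMap k g := by
  obtain ⟨H⟩ := h
  exact congrArg AddCommGrpCat.Hom.hom
    (TopCat.Homotopy.congr_homologyMap_singularChainComplexFunctor (f := f) (g := g) H
      (AddCommGrpCat.of (ULift.{u} ℤ)) k)

/-- Homotopy equivalences induce isomorphisms. -/
theorem bijective_of_homotopyInverse {f : X ⟶ Y} {g : Y ⟶ X}
    (hfg : (f ≫ g).hom.Homotopic (ContinuousMap.id X))
    (hgf : (g ≫ f).hom.Homotopic (ContinuousMap.id Y)) (k : ℕ) :
    Function.Bijective (intHomologyMap k f) := by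
  have h₁ : ∀ x, intHomologyMap k g (intHomologyMap k f x) = x := fun x => by
    rw [← intHomologyMap_comp, intHomologyMap_eq_of_homotopic k (g := 𝟙 X) hfg, intHomologyMap_id]
  have h₂ : ∀ y, intHomologyMap k f (intHomologyMap k g y) = y := fun y => by
    rw [← intHomologyMap_comp, intHomologyMap_eq_of_homotopic k (g := 𝟙 Y) hgf, intHomologyMap_id]
  exact ⟨Function.LeftInverse.injective h₁, Function.RightInverse.surjective h₂⟩

end Functoriality

section Point

/-- The map from a space to the one-point space. -/
abbrev toPoint (X : TopCat.{u}) : X ⟶ TopCat.of PUnit.{u + 1} :=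
  TopCat.ofHom (ContinuousMap.const X PUnit.unit)

theorem mem_reducedIntHomology {X : TopCat.{u}} {k : ℕ} {x : IntHomology k X} :
    x ∈ reducedIntHomology k X ↔ intHomologyMap k (toPoint X) x = 0 := Iff.rfl

theorem toPoint_map {X Y : TopCat.{u}} (f : X ⟶ Y) (k : ℕ) (x : IntHomology k X) :
    intHomologyMap k (toPoint Y) (intHomologyMap k f x) = intHomologyMap k (toPoint X) x := by
  rw [← intHomologyMap_comp]
  rfl

theorem point_homology_eq_zero {k : ℕ} (hk : k ≠ 0)
    (x : IntHomology k (TopCat.of PUnit.{u + 1})) : x = 0 :=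
  (AddCommGrpCat.subsingleton_of_isZero (isZero_singularHomologyFunctor_of_totallyDisconnectedSpace
    AddCommGrpCat.{u} k (AddCommGrpCat.of (ULift.{u} ℤ)) (TopCat.of PUnit.{u + 1}) hk)).elim _ _

/-- The homology of the point in degree `0` is infinite cyclic. -/
def pointHomologyEquiv : IntHomology 0 (TopCat.of PUnit.{u + 1}) ≃+ ℤ :=
  (asIso ((TopCat.of PUnit.{u + 1}).singularHomology₀ε
    (AddCommGrpCat.of (ULift.{u} ℤ)))).addCommGroupIsoToAddEquiv.trans AddEquiv.ulift

theorem toPoint_surjective (X : TopCat.{u}) [Nonempty X] (k : ℕ) :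
    Function.Surjective (intHomologyMap k (toPoint X)) := by
  let p : TopCat.of PUnit.{u + 1} ⟶ X :=
    TopCat.ofHom (ContinuousMap.const _ (Classical.arbitrary X))
  intro y
  refine ⟨intHomologyMap k p y, ?_⟩
  have hp : p ≫ toPoint X = 𝟙 _ := rfl
  rw [← intHomologyMap_comp, hp, intHomologyMap_id]

theorem homology_eq_zero_of_isEmpty (X : TopCat.{u}) [IsEmpty X] (k : ℕ) (x : IntHomology k X) :
    x = 0 := by
  have : IsEmpty C(TopSimplex k, X) := ⟨fun σ => IsEmpty.false (σ (stdSimplex.vertex 0))⟩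
  have : Subsingleton ((singChains X).X k) := (simplexBasis X k).repr.toEquiv.subsingleton
  obtain ⟨w, rfl⟩ := ChainComplexAb.homologyπ_surjective (K := singChains X) k x
  exact (ChainComplexAb.homologyπ_eq_zero_iff k w).2 ⟨0, Subsingleton.elim _ _⟩

/-- A space with the homology of a point. -/
def IsAcyclicSpace (X : TopCat.{u}) : Prop :=
  ∀ k, Function.Bijective (intHomologyMap k (toPoint X))

theorem IsAcyclicSpace.eq_zero {X : TopCat.{u}} (hX : IsAcyclicSpace X) {k : ℕ} (hk : k ≠ 0)
    (x : IntHomology k X) : x = 0 :=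
  (hX k).1 ((point_homology_eq_zero hk _).trans (point_homology_eq_zero hk _).symm)

theorem IsAcyclicSpace.map_eq_zero_iff_mem_reduced {A X : TopCat.{u}} (hX : IsAcyclicSpace X)
    (b : A ⟶ X) {k : ℕ} {z : IntHomology k A} :
    intHomologyMap k b z = 0 ↔ z ∈ reducedIntHomology k A := by
  rw [mem_reducedIntHomology, ← toPoint_map b]
  exact (map_eq_zero_iff (intHomologyMap k (toPoint X)) (hX k).1).symm

/-- A space with the homology of the `n`-sphere: reduced homology vanishes outside degree `n`, where
it is infinite cyclic. The empty space, whose reduced groups are all zero here, is not allowed. -/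
def IsHomologySphere (n : ℕ) (X : TopCat.{u}) : Prop :=
  (∀ k, k ≠ n → reducedIntHomology k X = ⊥) ∧
    ∃ e : IntHomology n X, AddSubgroup.zmultiples e = reducedIntHomology n X ∧
      ∀ m : ℤ, m • e = 0 → m = 0

theorem IsHomologySphere.of_bijective {n : ℕ} {X Y : TopCat.{u}} (hX : IsHomologySphere n X)
    (f : X ⟶ Y) (hf : ∀ k, Function.Bijective (intHomologyMap k f)) : IsHomologySphere n Y := by
  have hmap : ∀ k, reducedIntHomology k Y = (reducedIntHomology k X).map (intHomologyMap k f) := by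
    intro k
    ext y
    obtain ⟨x, rfl⟩ := (hf k).2 y
    rw [mem_reducedIntHomology, toPoint_map, ← mem_reducedIntHomology]
    exact ⟨fun h => ⟨x, h, rfl⟩, fun ⟨x', h, hx'⟩ => (hf k).1 hx' ▸ h⟩
  obtain ⟨h, e, he, he'⟩ := hX
  refine ⟨fun k hk => by rw [hmap, h k hk, AddSubgroup.map_bot], intHomologyMap n f e, ?_, ?_⟩
  · rw [hmap, ← he, AddMonoidHom.map_zmultiples]
  · intro m hm
    rw [← map_zsmul] at hm
    exact he' m ((map_eq_zero_iff _ (hf n).1).1 hm)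

/-- Any generator of the reduced homology of a homology sphere has infinite order. -/
theorem IsHomologySphere.eq_zero_of_zsmul {n : ℕ} {X : TopCat.{u}} (hX : IsHomologySphere n X)
    {e : IntHomology n X} (he : AddSubgroup.zmultiples e = reducedIntHomology n X) {m : ℤ}
    (hm : m • e = 0) : m = 0 := by
  obtain ⟨-, e', he', h⟩ := hX
  have : e' ∈ AddSubgroup.zmultiples e := by
    rw [he, ← he']; exact AddSubgroup.mem_zmultiples e'
  obtain ⟨l, rfl⟩ := AddSubgroup.mem_zmultiples_iff.1 this
  refine h m ?_
  rw [smul_comm, hm, smul_zero]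

end Point

namespace OpenCoverSquare

variable {A U V X : TopCat.{u}} {a : A ⟶ U} {b : A ⟶ V} {i : U ⟶ X} {j : V ⟶ X}

/-- If `V` is acyclic, then the kernel of `i_*` is the image of the reduced homology of `A`. -/
theorem map_left_eq_zero_iff (h : OpenCoverSquare a b i j) (hV : IsAcyclicSpace V) {k : ℕ}
    {x : IntHomology k U} : intHomologyMap k i x = 0 ↔
      ∃ z ∈ reducedIntHomology k A, intHomologyMap k a z = x := by
  constructor
  · intro hx
    obtain ⟨z, hz, hz'⟩ := h.mayerVietoris_middle k (x := x) (y := 0) (by rw [hx, map_zero])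
    exact ⟨z, (hV.map_eq_zero_iff_mem_reduced b).1 hz', hz⟩
  · rintro ⟨z, hz, rfl⟩
    rw [← intHomologyMap_comp, h.comm, intHomologyMap_comp,
      (hV.map_eq_zero_iff_mem_reduced b).2 hz, map_zero]

/-- If `V` is acyclic and meets `U`, then a sum of classes from `U` and `V` comes from `U`. -/
theorem exists_left_of_add (h : OpenCoverSquare a b i j) (hV : IsAcyclicSpace V) [Nonempty A]
    {k : ℕ} (u : IntHomology k U) (v : IntHomology k V) :
    ∃ u', intHomologyMap k i u' = intHomologyMap k i u + intHomologyMap k j v := by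
  obtain ⟨z, hz⟩ := toPoint_surjective A k (intHomologyMap k (toPoint V) v)
  have hv : v = intHomologyMap k b z := (hV k).1 (by rw [toPoint_map, hz])
  refine ⟨u + intHomologyMap k a z, ?_⟩
  rw [map_add, hv, ← intHomologyMap_comp, ← intHomologyMap_comp, h.comm]

theorem map_left_surjective_zero (h : OpenCoverSquare a b i j) (hV : IsAcyclicSpace V)
    [Nonempty A] : Function.Surjective (intHomologyMap 0 i) := by
  intro x
  obtain ⟨u, v, rfl⟩ := h.mayerVietoris_zero x
  exact h.exists_left_of_add hV u v

/-- The connecting homomorphism when `V` is acyclic and meets `U`. -/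
theorem exists_connecting_of_isAcyclicSpace (h : OpenCoverSquare a b i j) (hV : IsAcyclicSpace V)
    [Nonempty A] (k : ℕ) : ∃ δ : IntHomology (k + 1) X →+ IntHomology k A,
      (∀ x, δ x = 0 ↔ ∃ u, intHomologyMap (k + 1) i u = x) ∧
      (∀ z, (∃ x, δ x = z) ↔ intHomologyMap k a z = 0 ∧ z ∈ reducedIntHomology k A) := by
  obtain ⟨δ, h₁, h₂⟩ := h.mayerVietoris k
  refine ⟨δ, fun x => (h₁ x).trans ⟨?_, ?_⟩, fun z => (h₂ z).trans ?_⟩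
  · rintro ⟨u, v, rfl⟩
    exact h.exists_left_of_add hV u v
  · rintro ⟨u, rfl⟩
    exact ⟨u, 0, by rw [map_zero, add_zero]⟩
  · rw [hV.map_eq_zero_iff_mem_reduced b]

/-- Two acyclic open sets that meet in a homology `n`-sphere form a homology `(n + 1)`-sphere. -/
theorem isHomologySphere_succ (h : OpenCoverSquare a b i j) (hU : IsAcyclicSpace U)
    (hV : IsAcyclicSpace V) [Nonempty A] {n : ℕ} (hA : IsHomologySphere n A) :
    IsHomologySphere (n + 1) X := by
  have hinj : ∀ k, ∃ δ : IntHomology (k + 1) X →+ IntHomology k A, Function.Injective δ ∧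
      ∀ z, (∃ x, δ x = z) ↔ z ∈ reducedIntHomology k A := by
    intro k
    obtain ⟨δ, h₁, h₂⟩ := h.exists_connecting_of_isAcyclicSpace hV k
    refine ⟨δ, (injective_iff_map_eq_zero δ).2 fun x hx => ?_, fun z => (h₂ z).trans ?_⟩
    · obtain ⟨u, rfl⟩ := (h₁ x).1 hx
      rw [hU.eq_zero k.succ_ne_zero u, map_zero]
    · rw [hU.map_eq_zero_iff_mem_reduced, and_self]
  refine ⟨fun k hk => ?_, ?_⟩
  · rw [eq_bot_iff]
    intro x hx
    rw [AddSubgroup.mem_bot]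
    cases k with
    | zero =>
      obtain ⟨u, rfl⟩ := h.map_left_surjective_zero hV x
      rw [mem_reducedIntHomology, toPoint_map] at hx
      rw [(map_eq_zero_iff _ (hU 0).1).1 hx, map_zero]
    | succ k =>
      obtain ⟨δ, hδ, hr⟩ := hinj k
      refine (map_eq_zero_iff δ hδ).1 ?_
      have := (hr (δ x)).1 ⟨x, rfl⟩
      rwa [hA.1 k (by omega), AddSubgroup.mem_bot] at this
  · obtain ⟨δ, hδ, hr⟩ := hinj n
    obtain ⟨-, e, he, he'⟩ := hA
    obtain ⟨e₁, rfl⟩ := (hr e).2 (he ▸ AddSubgroup.mem_zmultiples e)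
    refine ⟨e₁, ?_, fun m hm => he' m (by rw [← map_zsmul, hm, map_zero])⟩
    ext x
    refine ⟨fun _ => point_homology_eq_zero n.succ_ne_zero _, fun _ => ?_⟩
    have := (hr (δ x)).1 ⟨x, rfl⟩
    rw [← he] at this
    obtain ⟨m, hm⟩ := AddSubgroup.mem_zmultiples_iff.1 this
    exact AddSubgroup.mem_zmultiples_iff.2 ⟨m, hδ (by rw [map_zsmul, hm])⟩

/-- For disjoint `U` and `V` with `V` acyclic, homology in positive degrees comes from `U`. -/
theorem map_left_bijective_of_isEmpty (h : OpenCoverSquare a b i j) (hV : IsAcyclicSpace V)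
    [IsEmpty A] {k : ℕ} (hk : k ≠ 0) : Function.Bijective (intHomologyMap k i) := by
  constructor
  · refine (injective_iff_map_eq_zero _).2 fun x hx => ?_
    obtain ⟨z, -, rfl⟩ := (h.map_left_eq_zero_iff hV).1 hx
    rw [homology_eq_zero_of_isEmpty A k z, map_zero]
  · intro x
    obtain ⟨k, rfl⟩ := Nat.exists_eq_succ_of_ne_zero hk
    obtain ⟨δ, h₁, -⟩ := h.mayerVietoris k
    obtain ⟨u, v, rfl⟩ := (h₁ x).1 (homology_eq_zero_of_isEmpty A k _)
    exact ⟨u, by rw [hV.eq_zero hk v, map_zero, add_zero]⟩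

/-- Degree `0` homology of a disjoint union. -/
theorem coprod_bijective_of_isEmpty (h : OpenCoverSquare a b i j) [IsEmpty A] :
    Function.Bijective ((intHomologyMap 0 i).coprod (intHomologyMap 0 j)) := by
  constructor
  · refine (injective_iff_map_eq_zero _).2 fun ⟨x, y⟩ hxy => ?_
    rw [AddMonoidHom.coprod_apply] at hxy
    obtain ⟨z, hz, hz'⟩ := h.mayerVietoris_middle 0 (x := x) (y := -y) (by
      rw [map_neg]; exact eq_neg_of_add_eq_zero_left hxy)
    rw [homology_eq_zero_of_isEmpty A 0 z, map_zero] at hz hz'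
    rw [← hz, neg_eq_zero.1 hz'.symm]
    rfl
  · intro x
    obtain ⟨u, v, rfl⟩ := h.mayerVietoris_zero x
    exact ⟨(u, v), rfl⟩

/-- Two disjoint acyclic open sets form a homology `0`-sphere. -/
theorem isHomologySphere_zero (h : OpenCoverSquare a b i j) (hU : IsAcyclicSpace U)
    (hV : IsAcyclicSpace V) [IsEmpty A] : IsHomologySphere 0 X := by
  refine ⟨fun k hk => ?_, ?_⟩
  · rw [eq_bot_iff]
    intro x _
    obtain ⟨u, rfl⟩ := (h.map_left_bijective_of_isEmpty hV hk).2 x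
    rw [hU.eq_zero hk u, map_zero]
    exact zero_mem _
  · let g := pointHomologyEquiv.{u}.symm 1
    have hg : ∀ y, y = pointHomologyEquiv y • g := fun y => by
      rw [← map_zsmul, smul_eq_mul, mul_one, AddEquiv.symm_apply_apply]
    have hg' : ∀ m : ℤ, m • g = 0 → m = 0 := fun m hm => by
      rw [← map_zsmul, smul_eq_mul, mul_one] at hm
      exact (map_eq_zero_iff _ pointHomologyEquiv.symm.injective).1 hm
    obtain ⟨u, hu⟩ := (hU 0).2 g
    obtain ⟨v, hv⟩ := (hV 0).2 g
    -- A generator of reduced homology: the difference of a point class of `U` and one of `V`.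
    refine ⟨intHomologyMap 0 i u - intHomologyMap 0 j v, ?_, fun m hm => ?_⟩
    · ext x
      rw [AddSubgroup.mem_zmultiples_iff]
      constructor
      · rintro ⟨m, rfl⟩
        refine AddSubgroup.zsmul_mem _ ?_ m
        rw [mem_reducedIntHomology, map_sub, toPoint_map, toPoint_map, hu, hv, sub_self]
      · intro hx
        obtain ⟨u', v', rfl⟩ := h.mayerVietoris_zero x
        rw [mem_reducedIntHomology, map_add, toPoint_map, toPoint_map] at hx
        refine ⟨pointHomologyEquiv (intHomologyMap 0 (toPoint U) u'), ?_⟩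
        have hu' : u' = pointHomologyEquiv (intHomologyMap 0 (toPoint U) u') • u :=
          (hU 0).1 (by rw [map_zsmul, hu, ← hg])
        have hv' : -v' = pointHomologyEquiv (intHomologyMap 0 (toPoint U) u') • v :=
          (hV 0).1 (by
            rw [map_zsmul, hv, ← hg, map_neg]
            exact (eq_neg_of_add_eq_zero_left hx).symm)
        rw [smul_sub, ← map_zsmul, ← map_zsmul, ← hu', ← hv', map_neg, sub_neg_eq_add]
    · have hinj := h.coprod_bijective_of_isEmpty.1
      have : (m • u, -(m • v)) = (0 : IntHomology 0 U × IntHomology 0 V) := by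
        refine (injective_iff_map_eq_zero _).1 hinj _ ?_
        rw [AddMonoidHom.coprod_apply, map_neg, map_zsmul, map_zsmul, ← sub_eq_add_neg, ← smul_sub,
          hm]
      have hmu : m • u = 0 := congrArg Prod.fst this
      refine hg' m ?_
      rw [← hu, ← map_zsmul, hmu, map_zero]

end OpenCoverSquare

end

/-! ### The homology of the sphere -/

section Subspace

variable {E : Type} [TopologicalSpace E]

/-- A subspace of `E`, lifted to the universe `u`. -/
abbrev subspace (s : Set E) : TopCat.{u} := TopCat.of (ULift.{u} s)

theorem isEmbedding_val (s : Set E) :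
    Topology.IsEmbedding fun x : subspace.{u} s => (x.down : E) :=
  Topology.IsEmbedding.subtypeVal.comp Homeomorph.ulift.isEmbedding

theorem isOpenEmbedding_val {s : Set E} (hs : IsOpen s) :
    Topology.IsOpenEmbedding fun x : subspace.{u} s => (x.down : E) :=
  hs.isOpenEmbedding_subtypeVal.comp Homeomorph.ulift.isOpenEmbedding

/-- The continuous map into a subspace determined by a continuous map into `E`. -/
def toSubspace {X : TopCat.{u}} {s : Set E} (g : C(X, E)) (hg : ∀ x, g x ∈ s) :
    X ⟶ subspace.{u} s :=
  TopCat.ofHom ⟨fun x => ⟨⟨g x, hg x⟩⟩, continuous_uliftUp.comp (g.continuous.subtype_mk hg)⟩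

/-- The inclusion of a subspace. -/
def subspaceInclusion (s : Set E) : C(subspace.{u} s, E) :=
  ⟨fun x => x.down, (isEmbedding_val s).continuous⟩

/-- The inclusion between two subspaces. -/
abbrev subspaceMap {s t : Set E} (h : s ⊆ t) : subspace.{u} s ⟶ subspace.{u} t :=
  toSubspace (subspaceInclusion s) fun x => h x.down.2

theorem openCoverSquare_subspace {s t : Set E} (hs : IsOpen s) (ht : IsOpen t) :
    OpenCoverSquare (subspaceMap.{u} (Set.inter_subset_left : s ∩ t ⊆ s))
      (subspaceMap (Set.inter_subset_right : s ∩ t ⊆ t))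
      (subspaceMap (Set.subset_union_left : s ⊆ s ∪ t))
      (subspaceMap (Set.subset_union_right : t ⊆ s ∪ t)) where
  comm := rfl
  isEmbedding := .of_comp (TopCat.Hom.hom _).continuous (isEmbedding_val s).continuous
    (isEmbedding_val (s ∩ t))
  isOpenEmbedding_left := .of_comp _ (isOpenEmbedding_val (hs.union ht)) (isOpenEmbedding_val hs)
  isOpenEmbedding_right := .of_comp _ (isOpenEmbedding_val (hs.union ht)) (isOpenEmbedding_val ht)
  cover := by
    rintro ⟨x, hx | hx⟩
    · exact .inl ⟨⟨x, hx⟩, rfl⟩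
    · exact .inr ⟨⟨x, hx⟩, rfl⟩
  exists_of_eq := by
    rintro ⟨x, hx⟩ ⟨y, hy⟩ h
    have hxy : x = y := congrArg (fun z : subspace.{u} (s ∪ t) => (z.down : E)) h
    exact ⟨⟨⟨x, hx, hxy ▸ hy⟩⟩, rfl⟩

variable [AddCommGroup E] [Module ℝ E] [ContinuousAdd E] [ContinuousSMul ℝ E]

/-- The straight-line homotopy. -/
theorem homotopic_of_segment {X : TopCat.{u}} {s : Set E} {f g : X ⟶ subspace.{u} s}
    (h : ∀ x, ∀ t : ℝ, 0 ≤ t → t ≤ 1 → (1 - t) • ((f x).down : E) + t • ((g x).down : E) ∈ s) :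
    f.hom.Homotopic g.hom := by
  have hc : ∀ k : X ⟶ subspace.{u} s, Continuous fun x => ((k x).down : E) := fun k =>
    (isEmbedding_val s).continuous.comp k.hom.continuous
  refine ⟨⟨⟨fun p => ⟨⟨(1 - (p.1 : ℝ)) • ((f p.2).down : E) + (p.1 : ℝ) • ((g p.2).down : E),
    h p.2 p.1 p.1.2.1 p.1.2.2⟩⟩, ?_⟩, fun x => ?_, fun x => ?_⟩⟩
  · refine continuous_uliftUp.comp (Continuous.subtype_mk ?_ _)
    have h₁ := (hc f).comp (continuous_snd (X := unitInterval))
    have h₂ := (hc g).comp (continuous_snd (X := unitInterval))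
    have h₃ : Continuous fun p : unitInterval × X => (p.1 : ℝ) :=
      continuous_subtype_val.comp continuous_fst
    exact ((continuous_const.sub h₃).smul h₁).add (h₃.smul h₂)
  · refine ULift.ext _ _ (Subtype.ext ?_)
    simp
  · refine ULift.ext _ _ (Subtype.ext ?_)
    simp

theorem isAcyclicSpace_of_starConvex {s : Set E} {p : E} (hp : p ∈ s) (h : StarConvex ℝ p s) :
    IsAcyclicSpace (subspace.{u} s) := by
  intro k
  refine bijective_of_homotopyInverse
    (g := TopCat.ofHom (ContinuousMap.const _ (ULift.up ⟨p, hp⟩))) ?_ (.refl _) k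
  refine homotopic_of_segment (f := TopCat.ofHom (ContinuousMap.const _ (ULift.up ⟨p, hp⟩)))
    (g := 𝟙 _) fun x t h₀ h₁ => ?_
  exact h x.down.2 (by linarith) h₀ (by ring)

end Subspace

section Sphere

/-- The points of `ℝ^(n+1)` outside a closed half-line, which is spanned by `-ε e₀`. -/
def slit (n : ℕ) (ε : ℝ) : Set (Fin (n + 1) → ℝ) := {x | 0 < ε * x 0 ∨ Fin.tail x ≠ 0}

theorem isOpen_slit (n : ℕ) (ε : ℝ) : IsOpen (slit n ε) := by
  refine IsOpen.union ?_ ?_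
  · exact isOpen_lt continuous_const (continuous_const.mul (continuous_apply 0))
  · exact isOpen_ne_fun (continuous_pi fun i => continuous_apply i.succ) continuous_const

theorem isAcyclicSpace_slit (n : ℕ) {ε : ℝ} (hε : ε ≠ 0) :
    IsAcyclicSpace (subspace.{u} (slit n ε)) := by
  have hε' : 0 < ε * ε := mul_self_pos.2 hε
  refine isAcyclicSpace_of_starConvex (p := Fin.cons ε 0) (.inl (by simpa using hε')) ?_
  intro x hx α β hα hβ hαβ
  by_cases hβ0 : β = 0
  · left
    have : α = 1 := by linarith
    simp [hβ0, this, hε']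
  · have hβ' : 0 < β := lt_of_le_of_ne hβ (Ne.symm hβ0)
    rcases hx with hx | hx
    · left
      simp only [Pi.add_apply, Pi.smul_apply, Fin.cons_zero, smul_eq_mul]
      nlinarith [mul_pos hβ' hx, mul_nonneg hα hε'.le]
    · right
      intro h
      refine hx (funext fun i => ?_)
      have := congrFun h i
      simpa [Fin.tail, hβ0] using this

theorem slit_inter (n : ℕ) : slit n 1 ∩ slit n (-1) = {x | Fin.tail x ≠ 0} := by
  ext x
  simp only [slit, Set.mem_inter_iff, Set.mem_ofPred_eq, one_mul, neg_mul]
  constructor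
  · rintro ⟨h₁ | h₁, h₂ | h₂⟩
    · linarith
    all_goals assumption
  · exact fun h => ⟨.inr h, .inr h⟩

theorem slit_union (n : ℕ) : slit n 1 ∪ slit n (-1) = {x | x ≠ 0} := by
  ext x
  simp only [slit, Set.mem_union, Set.mem_ofPred_eq, one_mul, neg_mul]
  constructor
  · rintro ((h | h) | (h | h)) rfl
    · simp at h
    · exact h rfl
    · simp at h
    · exact h rfl
  · intro h
    by_contra hc
    push Not at hc
    obtain ⟨⟨h₁, h₂⟩, h₃, -⟩ := hc
    refine h (funext fun i => Fin.cases ?_ (fun i => ?_) i)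
    · have : x 0 = 0 := by linarith
      exact this
    · exact congrFun h₂ i

/-- Punctured space `ℝ^(n+1) \ {0}` has the homology of the `n`-sphere. -/
theorem isHomologySphere_punctured (n : ℕ) :
    IsHomologySphere n (subspace.{u} {x : Fin (n + 1) → ℝ | x ≠ 0}) := by
  have hU := isAcyclicSpace_slit.{u} n (one_ne_zero)
  have hV := isAcyclicSpace_slit.{u} n (neg_ne_zero.2 one_ne_zero)
  have hsq := openCoverSquare_subspace.{u} (isOpen_slit n 1) (isOpen_slit n (-1))
  rw [← slit_union]
  cases n with
  | zero =>
    have : IsEmpty (subspace.{u} (slit 0 1 ∩ slit 0 (-1))) := by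
      refine ⟨fun x => ?_⟩
      have hx : Fin.tail (x.down : Fin 1 → ℝ) ≠ 0 := (slit_inter 0).le x.down.2
      exact hx (Subsingleton.elim _ _)
    exact hsq.isHomologySphere_zero hU hV
  | succ n =>
    have ih := isHomologySphere_punctured n
    have hA : IsHomologySphere n (subspace.{u} (slit (n + 1) 1 ∩ slit (n + 1) (-1))) := by
      rw [slit_inter]
      let p : subspace.{u} {x : Fin (n + 1) → ℝ | x ≠ 0} ⟶
          subspace.{u} {x : Fin (n + 2) → ℝ | Fin.tail x ≠ 0} :=
        toSubspace ⟨fun x => Fin.cons 0 (x.down : Fin (n + 1) → ℝ),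
          continuous_const.finCons (subspaceInclusion _).continuous⟩ fun x => x.down.2
      let q : subspace.{u} {x : Fin (n + 2) → ℝ | Fin.tail x ≠ 0} ⟶
          subspace.{u} {x : Fin (n + 1) → ℝ | x ≠ 0} :=
        toSubspace ⟨fun x => Fin.tail (x.down : Fin (n + 2) → ℝ),
          (continuous_pi fun i : Fin (n + 1) => continuous_apply i.succ).comp
            (subspaceInclusion _).continuous⟩ fun x => x.down.2
      have hqp : (q ≫ p).hom.Homotopic (ContinuousMap.id _) := by
        refine homotopic_of_segment (f := q ≫ p) (g := 𝟙 _) fun x t _ _ => ?_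
        have hx : Fin.tail (x.down : Fin (n + 2) → ℝ) ≠ 0 := x.down.2
        have heq : Fin.tail ((1 - t) • (((q ≫ p) x).down : Fin (n + 2) → ℝ) +
            t • (x.down : Fin (n + 2) → ℝ)) = Fin.tail (x.down : Fin (n + 2) → ℝ) := by
          funext i
          change (1 - t) * (x.down : Fin (n + 2) → ℝ) i.succ +
            t * (x.down : Fin (n + 2) → ℝ) i.succ = (x.down : Fin (n + 2) → ℝ) i.succ
          ring
        exact heq.trans_ne hx
      exact ih.of_bijective p (bijective_of_homotopyInverse (g := q) (.refl _) hqp)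
    have : Nonempty (subspace.{u} (slit (n + 1) 1 ∩ slit (n + 1) (-1))) := by
      rw [slit_inter]
      exact ⟨⟨⟨1, fun h => one_ne_zero (congrFun h 0)⟩⟩⟩
    exact hsq.isHomologySphere_succ hU hV hA

variable {E : Type} [NormedAddCommGroup E] [NormedSpace ℝ E] {s : Set E}

/-- The radial projection of a subset of `E \ {0}` to the unit sphere. -/
def radialProjection (hs : ∀ x ∈ s, x ≠ 0) :
    subspace.{u} s ⟶ subspace.{u} (Metric.sphere (0 : E) 1) :=
  toSubspace ⟨fun x => ‖(x.down : E)‖⁻¹ • (x.down : E),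
    ((subspaceInclusion s).continuous.norm.inv₀ fun x => norm_ne_zero_iff.2 (hs _ x.down.2)).smul
      (subspaceInclusion s).continuous⟩ fun x => by
    refine mem_sphere_zero_iff_norm.2 (norm_smul_inv_norm (𝕜 := ℝ) (hs _ x.down.2))

/-- The unit sphere, rescaled to radius `c`, as a map into a subset of `E`. -/
def scaledSphere (c : ℝ) (hs : ∀ y : E, ‖y‖ = 1 → c • y ∈ s) :
    subspace.{u} (Metric.sphere (0 : E) 1) ⟶ subspace.{u} s :=
  toSubspace ⟨fun y => c • (y.down : E), (subspaceInclusion _).continuous.const_smul c⟩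
    fun y => hs _ (mem_sphere_zero_iff_norm.1 y.down.2)

theorem scaledSphere_comp_radialProjection {c : ℝ} (hc : 0 < c)
    (hs : ∀ y : E, ‖y‖ = 1 → c • y ∈ s) (h₀ : ∀ x ∈ s, x ≠ 0) :
    scaledSphere.{u} c hs ≫ radialProjection h₀ = 𝟙 _ := by
  refine TopCat.hom_ext (ContinuousMap.ext fun y => ?_)
  have hy : ‖(y.down : E)‖ = 1 := mem_sphere_zero_iff_norm.1 y.down.2
  refine ULift.ext _ _ (Subtype.ext ?_)
  change ‖c • (y.down : E)‖⁻¹ • c • (y.down : E) = y.down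
  rw [norm_smul, hy, smul_smul, Real.norm_of_nonneg hc.le, mul_one, inv_mul_cancel₀ hc.ne',
    one_smul]

theorem bijective_scaledSphere {c : ℝ} (hc : 0 < c) (hs : ∀ y : E, ‖y‖ = 1 → c • y ∈ s)
    (h₀ : ∀ x ∈ s, x ≠ 0)
    (h : ∀ x ∈ s, ∀ t : ℝ, 0 ≤ t → t ≤ 1 → ((1 - t) * (c * ‖x‖⁻¹) + t) • x ∈ s) (k : ℕ) :
    Function.Bijective (intHomologyMap k (scaledSphere.{u} c hs)) := by
  refine bijective_of_homotopyInverse (g := radialProjection h₀) ?_ ?_ k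
  · rw [scaledSphere_comp_radialProjection hc]
    exact .refl _
  · refine homotopic_of_segment (f := radialProjection h₀ ≫ scaledSphere c hs) (g := 𝟙 _)
      fun x t ht₀ ht₁ => ?_
    have := h _ x.down.2 t ht₀ ht₁
    rw [add_smul, mul_smul, mul_smul] at this
    exact this

/-- Radial projection to the sphere is a homotopy equivalence if the segments from points of `s`
to their projections to the sphere of radius `c` stay in `s`. -/
theorem bijective_radialProjection {c : ℝ} (hc : 0 < c) (hs : ∀ y : E, ‖y‖ = 1 → c • y ∈ s)
    (h₀ : ∀ x ∈ s, x ≠ 0)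
    (h : ∀ x ∈ s, ∀ t : ℝ, 0 ≤ t → t ≤ 1 → ((1 - t) * (c * ‖x‖⁻¹) + t) • x ∈ s) (k : ℕ) :
    Function.Bijective (intHomologyMap k (radialProjection.{u} h₀)) := by
  refine (Function.Bijective.of_comp_iff _ (bijective_scaledSphere hc hs h₀ h k)).1 ?_
  have : ⇑(intHomologyMap k (radialProjection.{u} h₀)) ∘ intHomologyMap k (scaledSphere c hs) =
      id := by
    funext x
    rw [Function.comp_apply, ← intHomologyMap_comp, scaledSphere_comp_radialProjection hc,
      intHomologyMap_id, id]
  rw [this]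
  exact Function.bijective_id

/-- The sphere `S^n` is a homology `n`-sphere, being a deformation retract of `ℝ^(n+1) \ {0}`. -/
theorem isHomologySphere_diskBoundary (n : ℕ) :
    IsHomologySphere n (diskBoundary.{u} (n + 1)) := by
  let P : Set (EuclideanSpace ℝ (Fin (n + 1))) := {x | x ≠ 0}
  let p : subspace.{u} {x : Fin (n + 1) → ℝ | x ≠ 0} ⟶ subspace.{u} P :=
    toSubspace ⟨fun x => WithLp.toLp 2 (x.down : Fin (n + 1) → ℝ),
      (PiLp.continuous_toLp 2 _).comp (subspaceInclusion _).continuous⟩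
      fun x h => x.down.2 (congrArg WithLp.ofLp h)
  let q : subspace.{u} P ⟶ subspace.{u} {x : Fin (n + 1) → ℝ | x ≠ 0} :=
    toSubspace ⟨fun x => WithLp.ofLp (x.down : EuclideanSpace ℝ (Fin (n + 1))),
      (PiLp.continuous_ofLp 2 _).comp (subspaceInclusion _).continuous⟩
      fun x h => x.down.2 (congrArg (WithLp.toLp 2) h)
  have hP : IsHomologySphere n (subspace.{u} P) :=
    (isHomologySphere_punctured n).of_bijective p
      (bijective_of_homotopyInverse (g := q) (.refl _) (.refl _))
  have h₁ : ∀ y : EuclideanSpace ℝ (Fin (n + 1)), ‖y‖ = 1 → (1 : ℝ) • y ∈ P := by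
    rintro _ hy h
    rw [one_smul] at h
    simp [h] at hy
  refine hP.of_bijective (radialProjection fun x hx => hx)
    (bijective_radialProjection one_pos h₁ _ fun x hx t ht₀ ht₁ => ?_)
  refine smul_ne_zero (ne_of_gt ?_) hx
  have : 0 < ‖x‖⁻¹ := inv_pos.2 (norm_pos_iff.2 hx)
  rcases ht₀.eq_or_lt with rfl | ht
  · rw [sub_zero, one_mul, one_mul, add_zero]
    exact this
  · have := mul_nonneg (sub_nonneg.2 ht₁) this.le
    linarith

end Sphere

/-! ### The topology of an attached cell -/

namespace AttachCell

variable {r : ℕ} {X : TopCat.{u}} (f : diskBoundary.{u} r ⟶ X)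

/-- The point of the disk `D^r` with coordinates `y`. -/
def diskPoint (y : EuclideanSpace ℝ (Fin r)) (hy : ‖y‖ ≤ 1) : disk.{u} r :=
  ULift.up ⟨y, mem_closedBall_zero_iff.2 hy⟩

/-- The coordinates of a point of the disk `D^r`. -/
def diskCoord : C(disk.{u} r, EuclideanSpace ℝ (Fin r)) := subspaceInclusion (Metric.closedBall 0 1)

theorem norm_diskCoord_le (y : disk.{u} r) : ‖diskCoord y‖ ≤ 1 :=
  mem_closedBall_zero_iff.1 y.down.2

theorem isEmbedding_diskCoord : Topology.IsEmbedding (diskCoord.{u} (r := r)) :=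
  isEmbedding_val (Metric.closedBall 0 1)

theorem norm_diskCoord_boundary (y : diskBoundary.{u} r) :
    ‖diskCoord (diskBoundaryInclusion r y)‖ = 1 :=
  mem_sphere_zero_iff_norm.1 y.down.2

/-- The map `X → X_f`. -/
def base (x : X) : attachCell r f := Quot.mk _ (Sum.inl x)

/-- The characteristic map `D^r → X_f` of the cell. -/
def cell (y : disk.{u} r) : attachCell r f := Quot.mk _ (Sum.inr y)

theorem continuous_base : Continuous (base f) := continuous_quot_mk.comp continuous_inl

theorem continuous_cell : Continuous (cell f) := continuous_quot_mk.comp continuous_inr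

theorem cell_boundary (y : diskBoundary.{u} r) :
    cell f (diskBoundaryInclusion r y) = base f (f y) :=
  Quot.sound (CellGlue.glue y)

variable {f} in
theorem induction_on {P : attachCell r f → Prop} (h₁ : ∀ x, P (base f x)) (h₂ : ∀ y, P (cell f y))
    (p : attachCell r f) : P p :=
  Quot.ind (fun s => Sum.rec h₁ h₂ s) p

theorem isOpen_iff {s : Set (attachCell r f)} :
    IsOpen s ↔ IsOpen (base f ⁻¹' s) ∧ IsOpen (cell f ⁻¹' s) :=
  isOpen_coinduced.trans isOpen_sum_iff

/-- The function `X_f → ℝ` that is `1` on `X` and the norm on the cell. -/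
def radius : C(attachCell r f, ℝ) where
  toFun := Quot.lift (Sum.elim (fun _ => 1) fun y => ‖diskCoord y‖) fun _ _ ⟨y⟩ =>
    norm_diskCoord_boundary y
  continuous_toFun := continuous_quot_lift _ (continuous_const.sumElim diskCoord.continuous.norm)

/-- The map `X_f → ℝ^r` that is `0` on `X` and `y ↦ (1 - ‖y‖) y` on the cell. Together with
`radius` it recovers the coordinates of a point of the open cell. -/
def cellCoord : C(attachCell r f, EuclideanSpace ℝ (Fin r)) where
  toFun := Quot.lift (Sum.elim (fun _ => 0) fun y => (1 - ‖diskCoord y‖) • diskCoord y)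
    fun _ _ ⟨y⟩ => by simp [norm_diskCoord_boundary]
  continuous_toFun := continuous_quot_lift _ (continuous_const.sumElim
    ((continuous_const.sub diskCoord.continuous.norm).smul diskCoord.continuous))

theorem radius_cell (y : disk.{u} r) : radius f (cell f y) = ‖diskCoord y‖ := rfl

theorem diskCoord_eq_of_cell_eq {y z : disk.{u} r} (hy : ‖diskCoord y‖ < 1)
    (h : cell f y = cell f z) : diskCoord y = diskCoord z := by
  have h₁ : ‖diskCoord y‖ = ‖diskCoord z‖ := congrArg (radius f) h
  have h₂ : (1 - ‖diskCoord y‖) • diskCoord y = (1 - ‖diskCoord z‖) • diskCoord z :=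
    congrArg (cellCoord f) h
  rw [← h₁] at h₂
  exact smul_right_injective _ (sub_pos.2 hy).ne' h₂

/-- The open cell, as the open unit ball. -/
abbrev OpenCell (r : ℕ) : TopCat.{u} := subspace (Metric.ball (0 : EuclideanSpace ℝ (Fin r)) 1)

/-- The open cell without its centre. -/
abbrev PuncturedCell (r : ℕ) : TopCat.{u} :=
  subspace {y : EuclideanSpace ℝ (Fin r) | ‖y‖ < 1 ∧ y ≠ 0}

/-- The complement in `X_f` of the centre of the cell. -/
abbrev Punctured : TopCat.{u} := TopCat.of {p : attachCell r f // 0 < radius f p}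

/-- The inclusion of the open cell. -/
def openCellInclusion : OpenCell.{u} r ⟶ attachCell r f :=
  TopCat.ofHom ⟨fun y => cell f (diskPoint y.down (mem_ball_zero_iff.1 y.down.2).le),
    (continuous_cell f).comp (toSubspace (s := Metric.closedBall 0 1) (subspaceInclusion _)
      fun y => Metric.ball_subset_closedBall y.down.2).hom.continuous⟩

/-- The inclusion of the complement of the centre. -/
def puncturedInclusion : Punctured f ⟶ attachCell r f :=
  TopCat.ofHom ⟨Subtype.val, continuous_subtype_val⟩

theorem isOpenEmbedding_puncturedInclusion : Topology.IsOpenEmbedding (puncturedInclusion f) :=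
  (isOpen_lt continuous_const (radius f).continuous).isOpenEmbedding_subtypeVal

theorem openCellInclusion_eq_cell_iff {y : OpenCell.{u} r} {z : disk.{u} r} :
    openCellInclusion f y = cell f z ↔ y.down.1 = diskCoord z := by
  have hy : ‖y.down.1‖ < 1 := mem_ball_zero_iff.1 y.down.2
  exact ⟨diskCoord_eq_of_cell_eq f (y := diskPoint y.down.1 hy.le) hy, fun h =>
    congrArg (cell f) (isEmbedding_diskCoord.injective (a₁ := diskPoint y.down.1 hy.le) h)⟩

theorem isOpenEmbedding_openCellInclusion : Topology.IsOpenEmbedding (openCellInclusion f) := by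
  refine .of_continuous_injective_isOpenMap (openCellInclusion f).hom.continuous ?_ ?_
  · intro y z h
    have hz : ‖z.down.1‖ < 1 := mem_ball_zero_iff.1 z.down.2
    exact ULift.ext _ _ (Subtype.ext
      ((openCellInclusion_eq_cell_iff f (z := diskPoint z.down.1 hz.le)).1 h))
  · intro W hW
    refine (isOpen_iff f).2 ⟨?_, ?_⟩
    · convert isOpen_empty
      refine Set.eq_empty_of_forall_notMem ?_
      rintro x ⟨y, -, hy⟩
      have : ‖(y.down : EuclideanSpace ℝ (Fin r))‖ = 1 := congrArg (radius f) hy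
      exact (mem_ball_zero_iff.1 y.down.2).ne this
    · have := ((isOpenEmbedding_val Metric.isOpen_ball).isOpenMap W hW).preimage
        (diskCoord.{u} (r := r)).continuous
      convert this using 1
      ext z
      constructor
      · rintro ⟨y, hy, h⟩
        exact ⟨y, hy, (openCellInclusion_eq_cell_iff f).1 h⟩
      · rintro ⟨y, hy, h⟩
        exact ⟨y, hy, (openCellInclusion_eq_cell_iff f).2 h⟩

/-- The inclusion of the punctured open cell into the complement of the centre. -/
def puncturedCellInclusion : PuncturedCell.{u} r ⟶ Punctured f :=
  TopCat.ofHom ⟨fun y => ⟨cell f (diskPoint y.down y.down.2.1.le),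
    norm_pos_iff.2 y.down.2.2⟩, ((continuous_cell f).comp
      (toSubspace (s := Metric.closedBall 0 1) (subspaceInclusion _)
        fun y => mem_closedBall_zero_iff.2 y.down.2.1.le).hom.continuous).subtype_mk _⟩

/-- The complement of the centre and the open cell cover `X_f`. -/
theorem openCoverSquare : OpenCoverSquare (puncturedCellInclusion f)
    (subspaceMap fun _ hy => mem_ball_zero_iff.2 hy.1 : PuncturedCell.{u} r ⟶ OpenCell r)
    (puncturedInclusion f) (openCellInclusion f) where
  comm := rfl
  isEmbedding := by
    have h : Topology.IsEmbedding
        (subspaceMap fun _ hy => mem_ball_zero_iff.2 hy.1 : PuncturedCell.{u} r ⟶ OpenCell r) :=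
      .of_comp (TopCat.Hom.hom _).continuous (isEmbedding_val _).continuous (isEmbedding_val _)
    exact .of_comp (TopCat.Hom.hom _).continuous (puncturedInclusion f).hom.continuous
      ((isOpenEmbedding_openCellInclusion f).isEmbedding.comp h)
  isOpenEmbedding_left := isOpenEmbedding_puncturedInclusion f
  isOpenEmbedding_right := isOpenEmbedding_openCellInclusion f
  cover := induction_on (fun x => .inl ⟨⟨base f x, one_pos⟩, rfl⟩) fun y => by
    rcases (norm_diskCoord_le y).lt_or_eq with h | h
    · exact .inr ⟨⟨⟨diskCoord y, mem_ball_zero_iff.2 h⟩⟩, rfl⟩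
    · exact .inl ⟨⟨cell f y, (radius_cell f y).trans h ▸ one_pos⟩, rfl⟩
  exists_of_eq := by
    rintro ⟨p, hp⟩ y h
    obtain rfl : p = openCellInclusion f y := h
    exact ⟨⟨⟨y.down, mem_ball_zero_iff.1 y.down.2, norm_pos_iff.1 hp⟩⟩, rfl⟩

theorem isAcyclicSpace_openCell (r : ℕ) : IsAcyclicSpace (OpenCell.{u} r) :=
  isAcyclicSpace_of_starConvex (Metric.mem_ball_self one_pos)
    ((convex_ball _ _).starConvex (Metric.mem_ball_self one_pos))

/-- The closed disk without its centre. -/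
abbrev PuncturedDisk (r : ℕ) : TopCat.{u} :=
  subspace {y : EuclideanSpace ℝ (Fin r) | ‖y‖ ≤ 1 ∧ y ≠ 0}

/-- The inclusion of `X` into the complement of the centre. -/
def puncturedBase : X ⟶ Punctured f :=
  TopCat.ofHom ⟨fun x => ⟨base f x, one_pos⟩, (continuous_base f).subtype_mk _⟩

/-- The inclusion of the punctured closed disk into the complement of the centre. -/
def puncturedDisk : PuncturedDisk.{u} r ⟶ Punctured f :=
  TopCat.ofHom ⟨fun y => ⟨cell f (diskPoint y.down y.down.2.1),
    norm_pos_iff.2 y.down.2.2⟩, ((continuous_cell f).comp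
      (toSubspace (s := Metric.closedBall 0 1) (subspaceInclusion _)
        fun y => mem_closedBall_zero_iff.2 y.down.2.1).hom.continuous).subtype_mk _⟩

theorem punctured_induction_on {P : Punctured f → Prop} (h₁ : ∀ x, P (puncturedBase f x))
    (h₂ : ∀ y, P (puncturedDisk f y)) (p : Punctured f) : P p := by
  obtain ⟨p, hp⟩ := p
  induction p using induction_on with
  | h₁ x => exact h₁ x
  | h₂ y => exact h₂ ⟨⟨diskCoord y, norm_diskCoord_le y, norm_pos_iff.1 hp⟩⟩

/-- The complement of the centre is a quotient of `X ⊔ (D^r \ {0})`. -/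
theorem isQuotientMap_punctured :
    Topology.IsQuotientMap (Sum.elim (puncturedBase f) (puncturedDisk f)) := by
  refine (Topology.isQuotientMap_iff _).2
    ⟨Topology.isCoinducing_iff.2 fun s => ⟨fun hs => ?_, fun hs => ?_⟩, fun p => ?_⟩
  · obtain ⟨h₁, h₂⟩ := isOpen_sum_iff.1 hs
    rw [(isOpenEmbedding_puncturedInclusion f).isOpen_iff_image_isOpen, isOpen_iff]
    constructor
    · convert h₁ using 1
      ext x
      refine ⟨?_, fun h => ⟨puncturedBase f x, h, rfl⟩⟩
      rintro ⟨p, hp, h⟩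
      obtain rfl : p = puncturedBase f x := Subtype.ext h
      exact hp
    · obtain ⟨t, ht, ht'⟩ := (isEmbedding_val _).isOpen_iff.1 h₂
      have hmem (z : PuncturedDisk.{u} r) : z.down.1 ∈ t ↔ puncturedDisk f z ∈ s :=
        Set.ext_iff.1 ht' z
      have : IsOpen (diskCoord.{u} (r := r) ⁻¹' (t ∩ {y | y ≠ 0})) :=
        (ht.inter isOpen_ne).preimage diskCoord.continuous
      convert this using 1
      ext y
      constructor
      · rintro ⟨⟨p, hp₀⟩, hp, h⟩
        obtain rfl : p = cell f y := h
        have hy : diskCoord y ≠ 0 := norm_pos_iff.1 hp₀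
        exact ⟨(hmem ⟨⟨diskCoord y, norm_diskCoord_le y, hy⟩⟩).2 hp, hy⟩
      · rintro ⟨h₁, h₂⟩
        exact ⟨_, (hmem ⟨⟨diskCoord y, norm_diskCoord_le y, h₂⟩⟩).1 h₁, rfl⟩
  · exact hs.preimage ((puncturedBase f).hom.continuous.sumElim (puncturedDisk f).hom.continuous)
  · induction p using punctured_induction_on with
    | h₁ x => exact ⟨.inl x, rfl⟩
    | h₂ y => exact ⟨.inr y, rfl⟩

open Classical in
/-- The underlying function of the retraction of `X_f \ {0}` to `X`; it is `none` at the
centre. The values in `Option X` serve to define it by descent from `X ⊔ D^r`, without a junk point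
of `X`, which may be empty. -/
def retractionFun : attachCell r f → Option X :=
  Quot.lift (Sum.elim some fun y =>
    if h : diskCoord y ≠ 0 then some (f (radialProjection (s := {y | y ≠ 0}) (fun _ h => h)
      ⟨⟨diskCoord y, h⟩⟩)) else none) fun _ _ ⟨y⟩ => by
    have hy := norm_diskCoord_boundary y
    have h₀ : diskCoord (diskBoundaryInclusion r y) ≠ 0 := norm_pos_iff.1 (hy ▸ one_pos)
    simp only [Sum.elim_inr, Sum.elim_inl, dif_pos h₀]
    congr 2
    refine ULift.ext _ _ (Subtype.ext ?_)
    change ‖diskCoord (diskBoundaryInclusion r y)‖⁻¹ • diskCoord (diskBoundaryInclusion r y) =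
      y.down.1
    rw [hy, inv_one, one_smul]
    rfl

theorem retractionFun_puncturedDisk (y : PuncturedDisk.{u} r) :
    retractionFun f (puncturedDisk f y).1 = some (f (radialProjection (fun _ h => h.2) y)) :=
  dif_pos y.down.2.2

/-- The complement of the centre of the cell retracts to `X`, by radial projection on the cell. -/
theorem exists_retraction : ∃ ρ : Punctured f ⟶ X, (∀ x, ρ (puncturedBase f x) = x) ∧
    ∀ y, ρ (puncturedDisk f y) = f (radialProjection (fun _ h => h.2) y) := by
  let g : C(X ⊕ PuncturedDisk.{u} r, X) :=
    ⟨Sum.elim id (radialProjection (fun _ h => h.2) ≫ f),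
      continuous_id.sumElim (radialProjection (fun _ h => h.2) ≫ f).hom.continuous⟩
  let q : C(X ⊕ PuncturedDisk.{u} r, Punctured f) :=
    ⟨Sum.elim (puncturedBase f) (puncturedDisk f), (isQuotientMap_punctured f).continuous⟩
  have hq : Topology.IsQuotientMap q := isQuotientMap_punctured f
  have hg : ∀ s, some (g s) = retractionFun f (q s).1 := by
    rintro (x | y)
    · rfl
    · exact (retractionFun_puncturedDisk f y).symm
  have hfac : Function.FactorsThrough g q := fun s t h =>
    Option.some_injective _ (by rw [hg, hg, h])
  refine ⟨TopCat.ofHom (hq.lift g hfac), fun x => ?_, fun y => ?_⟩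
  · exact DFunLike.congr_fun (hq.lift_comp g hfac) (.inl x)
  · exact DFunLike.congr_fun (hq.lift_comp g hfac) (.inr y)

theorem norm_sweep (y : EuclideanSpace ℝ (Fin r)) (hy : y ≠ 0) {t : ℝ} (h₀ : 0 ≤ t)
    (h₁ : t ≤ 1) : ‖((1 - t) * ‖y‖⁻¹ + t) • y‖ = (1 - t) + t * ‖y‖ := by
  have := norm_pos_iff.2 hy
  rw [norm_smul, Real.norm_of_nonneg (add_nonneg
    (mul_nonneg (sub_nonneg.2 h₁) (inv_nonneg.2 this.le)) h₀)]
  field_simp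

theorem norm_sweep_le (y : EuclideanSpace ℝ (Fin r)) (hy : ‖y‖ ≤ 1) {t : ℝ} (h₀ : 0 ≤ t)
    (h₁ : t ≤ 1) : ‖((1 - t) * ‖y‖⁻¹ + t) • y‖ ≤ 1 := by
  by_cases h : y = 0
  · simp [h]
  · rw [norm_sweep y h h₀ h₁]
    nlinarith

/-- The radial homotopy on `X_f`; it is the identity at time `1`, is constant on `X`, and pushes
the cell without its centre to its boundary at time `0`. It fixes the centre, where it is not
continuous. -/
def sweep (t : unitInterval) : attachCell r f → attachCell r f :=
  Quot.lift (Sum.elim (base f) fun y =>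
    cell f (diskPoint (((1 - (t : ℝ)) * ‖diskCoord y‖⁻¹ + t) • diskCoord y)
      (norm_sweep_le _ (norm_diskCoord_le y) t.2.1 t.2.2))) fun _ _ ⟨y⟩ => by
    refine ((congrArg (cell f) ?_)).trans (cell_boundary f y)
    refine isEmbedding_diskCoord.injective ?_
    change ((1 - (t : ℝ)) * ‖diskCoord (diskBoundaryInclusion r y)‖⁻¹ + t) •
      diskCoord (diskBoundaryInclusion r y) = _
    rw [norm_diskCoord_boundary, inv_one, mul_one, sub_add_cancel, one_smul]

theorem radius_sweep_pos (t : unitInterval) (p : Punctured f) : 0 < radius f (sweep f t p.1) := by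
  induction p using punctured_induction_on with
  | h₁ x => exact one_pos
  | h₂ y =>
    have h₀ : 0 < ‖y.down.1‖ := norm_pos_iff.2 y.down.2.2
    refine lt_of_lt_of_eq ?_ (norm_sweep y.down.1 y.down.2.2 t.2.1 t.2.2).symm
    rcases t.2.1.eq_or_lt with h | h
    · rw [← h]; norm_num
    · exact add_pos_of_nonneg_of_pos (sub_nonneg.2 t.2.2) (mul_pos h h₀)

theorem homotopic_retraction {ρ : Punctured f ⟶ X} (h₁ : ∀ x, ρ (puncturedBase f x) = x)
    (h₂ : ∀ y, ρ (puncturedDisk f y) = f (radialProjection (fun _ h => h.2) y)) :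
    (ρ ≫ puncturedBase f).hom.Homotopic (ContinuousMap.id _) := by
  refine ⟨⟨⟨fun p => ⟨sweep f p.1 p.2.1, radius_sweep_pos f p.1 p.2⟩, ?_⟩,
    fun p => ?_, fun p => ?_⟩⟩
  · refine (isQuotientMap_punctured f).continuous_lift_prod_right ?_
    rw [← Homeomorph.prodSumDistrib.symm.comp_continuous_iff', continuous_sum_dom]
    constructor
    · exact (puncturedBase f).hom.continuous.comp continuous_snd
    · refine Continuous.subtype_mk ((continuous_cell f).comp
        (isEmbedding_diskCoord.continuous_iff.2 ?_)) _
      have hy : Continuous fun p : unitInterval × PuncturedDisk.{u} r => p.2.down.1 :=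
        (subspaceInclusion _).continuous.comp continuous_snd
      have ht : Continuous fun p : unitInterval × PuncturedDisk.{u} r => (p.1 : ℝ) :=
        continuous_subtype_val.comp continuous_fst
      exact (((continuous_const.sub ht).mul (hy.norm.inv₀ fun p =>
        norm_ne_zero_iff.2 p.2.down.2.2)).add ht).smul hy
  · refine Subtype.ext ?_
    induction p using punctured_induction_on with
    | h₁ x => exact congrArg (base f) (h₁ x).symm
    | h₂ y =>
      refine Eq.trans ?_ (congrArg (base f) (h₂ y).symm)
      refine Eq.trans (congrArg (cell f) (isEmbedding_diskCoord.injective ?_)) (cell_boundary f _)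
      change ((1 - (0 : ℝ)) * ‖y.down.1‖⁻¹ + 0) • y.down.1 = ‖y.down.1‖⁻¹ • y.down.1
      rw [sub_zero, one_mul, add_zero]
  · refine Subtype.ext ?_
    induction p using punctured_induction_on with
    | h₁ x => rfl
    | h₂ y =>
      refine congrArg (cell f) (isEmbedding_diskCoord.injective ?_)
      change ((1 - (1 : ℝ)) * ‖y.down.1‖⁻¹ + 1) • y.down.1 = y.down.1
      rw [sub_self, zero_mul, zero_add, one_smul]

theorem bijective_puncturedBase (k : ℕ) :
    Function.Bijective (intHomologyMap k (puncturedBase f)) := by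
  obtain ⟨ρ, h₁, h₂⟩ := exists_retraction f
  refine bijective_of_homotopyInverse (g := ρ) ?_ (homotopic_retraction f h₁ h₂) k
  have : puncturedBase f ≫ ρ = 𝟙 X := TopCat.hom_ext (ContinuousMap.ext h₁)
  rw [this]
  exact .refl _

theorem half_smul_mem (y : EuclideanSpace ℝ (Fin r)) (hy : ‖y‖ = 1) :
    (1 / 2 : ℝ) • y ∈ {y : EuclideanSpace ℝ (Fin r) | ‖y‖ < 1 ∧ y ≠ 0} := by
  refine ⟨by rw [norm_smul, hy]; norm_num, smul_ne_zero (by norm_num) ?_⟩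
  rintro rfl
  simp at hy

/-- The sphere of radius `1/2` in the punctured open cell. -/
def innerSphere : diskBoundary.{u} r ⟶ PuncturedCell.{u} r :=
  scaledSphere (1 / 2) half_smul_mem

theorem bijective_innerSphere (k : ℕ) :
    Function.Bijective (intHomologyMap k (innerSphere.{u} (r := r))) := by
  refine bijective_scaledSphere (by norm_num) _ (fun x hx => hx.2) (fun x hx t h₀ h₁ => ?_) k
  have hx' : 0 < ‖x‖ := norm_pos_iff.2 hx.2
  have hpos : 0 < (1 - t) * (1 / 2 * ‖x‖⁻¹) + t := by
    rcases h₀.eq_or_lt with rfl | h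
    · simpa using hx.2
    · have := mul_nonneg (sub_nonneg.2 h₁) (mul_pos one_half_pos (inv_pos.2 hx')).le
      linarith
  refine ⟨?_, smul_ne_zero hpos.ne' hx.2⟩
  rw [norm_smul, Real.norm_of_nonneg hpos.le, add_mul, mul_assoc, mul_assoc,
    inv_mul_cancel₀ hx'.ne']
  nlinarith [hx.1]

/-- In the complement of the centre, the inner sphere is homotopic to the attaching map. -/
theorem map_innerSphere (k : ℕ) (z : IntHomology k (diskBoundary.{u} r)) :
    intHomologyMap k (puncturedCellInclusion f) (intHomologyMap k innerSphere z) =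
      intHomologyMap k (puncturedBase f) (intHomologyMap k f z) := by
  obtain ⟨ρ, h₁, h₂⟩ := exists_retraction f
  have hf : (innerSphere ≫ puncturedCellInclusion f) ≫ ρ = f := by
    refine TopCat.hom_ext (ContinuousMap.ext fun y => ?_)
    refine (h₂ (subspaceMap (t := {y : EuclideanSpace ℝ (Fin r) | ‖y‖ ≤ 1 ∧ y ≠ 0})
      (fun _ h => ⟨h.1.le, h.2⟩) (innerSphere y))).trans (congrArg f ?_)
    exact DFunLike.congr_fun (congrArg TopCat.Hom.hom
      (scaledSphere_comp_radialProjection.{u} one_half_pos half_smul_mem fun _ h => h.2)) y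
  have hid : intHomologyMap k (ρ ≫ puncturedBase f) = intHomologyMap k (𝟙 _) :=
    intHomologyMap_eq_of_homotopic k (homotopic_retraction f h₁ h₂)
  rw [← intHomologyMap_comp, ← intHomologyMap_id k (intHomologyMap k (innerSphere ≫ _) z), ← hid,
    intHomologyMap_comp, ← intHomologyMap_comp k _ ρ, hf]

end AttachCell

/-! ### The homology of an attached cell -/

namespace AttachCell

section PositiveDimension

variable {r : ℕ} {X : TopCat.{u}} (f : diskBoundary.{u} r ⟶ X)

theorem map_inclusion (k : ℕ) (x : IntHomology k X) :
    intHomologyMap k (attachCellInclusion r f) x =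
      intHomologyMap k (puncturedInclusion f) (intHomologyMap k (puncturedBase f) x) :=
  intHomologyMap_comp k (puncturedBase f) (puncturedInclusion f) x

theorem mem_reduced_innerSphere {k : ℕ} {z : IntHomology k (diskBoundary.{u} r)} :
    intHomologyMap k innerSphere z ∈ reducedIntHomology k (PuncturedCell.{u} r) ↔
      z ∈ reducedIntHomology k (diskBoundary.{u} r) := by
  rw [mem_reducedIntHomology, toPoint_map, mem_reducedIntHomology]

/-- The kernel of `i_*` is the image of the reduced homology of the sphere. -/
theorem map_inclusion_eq_zero_iff {k : ℕ} {x : IntHomology k X} :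
    intHomologyMap k (attachCellInclusion r f) x = 0 ↔
      ∃ z ∈ reducedIntHomology k (diskBoundary.{u} r), intHomologyMap k f z = x := by
  rw [map_inclusion, (openCoverSquare f).map_left_eq_zero_iff (isAcyclicSpace_openCell r)]
  constructor
  · rintro ⟨z, hz, h⟩
    obtain ⟨w, rfl⟩ := (bijective_innerSphere k).2 z
    rw [map_innerSphere] at h
    exact ⟨w, mem_reduced_innerSphere.1 hz, (bijective_puncturedBase f k).1 h⟩
  · rintro ⟨w, hw, rfl⟩
    exact ⟨_, mem_reduced_innerSphere.2 hw, map_innerSphere f k w⟩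

theorem map_inclusion_surjective_zero [Nonempty (diskBoundary.{u} r)] :
    Function.Surjective (intHomologyMap 0 (attachCellInclusion r f)) := by
  have : Nonempty (PuncturedCell.{u} r) := ‹Nonempty (diskBoundary.{u} r)›.map innerSphere
  intro x
  obtain ⟨y, rfl⟩ :=
    (openCoverSquare f).map_left_surjective_zero (isAcyclicSpace_openCell r) x
  obtain ⟨z, rfl⟩ := (bijective_puncturedBase f 0).2 y
  exact ⟨z, map_inclusion f 0 z⟩

/-- The boundary map `H_{k+1}(X_f) → H_k(S^{r-1})` of the cell. -/
theorem exists_connecting [Nonempty (diskBoundary.{u} r)] (k : ℕ) :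
    ∃ δ : IntHomology (k + 1) (attachCell r f) →+ IntHomology k (diskBoundary.{u} r),
      (∀ x, δ x = 0 ↔ ∃ u, intHomologyMap (k + 1) (attachCellInclusion r f) u = x) ∧
      ∀ z, (∃ x, δ x = z) ↔
        intHomologyMap k f z = 0 ∧ z ∈ reducedIntHomology k (diskBoundary.{u} r) := by
  have : Nonempty (PuncturedCell.{u} r) := ‹Nonempty (diskBoundary.{u} r)›.map innerSphere
  obtain ⟨δ, h₁, h₂⟩ :=
    (openCoverSquare f).exists_connecting_of_isAcyclicSpace (isAcyclicSpace_openCell r) k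
  let s := AddEquiv.ofBijective _ (bijective_innerSphere.{u} (r := r) k)
  refine ⟨s.symm.toAddMonoidHom.comp δ, fun x => ?_, fun z => ?_⟩
  · refine (map_eq_zero_iff s.symm s.symm.injective).trans ((h₁ x).trans ?_)
    exact ((bijective_puncturedBase f (k + 1)).2.exists.trans
      (exists_congr fun u => by rw [map_inclusion])).symm.symm
  · refine Iff.trans (exists_congr fun x => s.symm_apply_eq) ((h₂ (s z)).trans ?_)
    refine and_congr ?_ mem_reduced_innerSphere
    refine (iff_of_eq (congrArg (· = 0) (map_innerSphere f k z))).trans ?_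
    exact map_eq_zero_iff (intHomologyMap k (puncturedBase f)) (bijective_puncturedBase f k).1

end PositiveDimension

section Succ

variable {n : ℕ} {X : TopCat.{u}} (f : diskBoundary.{u} (n + 1) ⟶ X)

instance : Nonempty (diskBoundary.{u} (n + 1)) := by
  obtain ⟨y, hy⟩ := NormedSpace.sphere_nonempty (x := (0 : EuclideanSpace ℝ (Fin (n + 1)))).2
    zero_le_one
  exact ⟨⟨⟨y, hy⟩⟩⟩

theorem map_inclusion_injective {k : ℕ} (hk : k ≠ n) :
    Function.Injective (intHomologyMap k (attachCellInclusion (n + 1) f)) := by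
  refine (injective_iff_map_eq_zero _).2 fun x hx => ?_
  obtain ⟨z, hz, rfl⟩ := (map_inclusion_eq_zero_iff f).1 hx
  rw [(isHomologySphere_diskBoundary n).1 k hk, AddSubgroup.mem_bot] at hz
  rw [hz, map_zero]

theorem map_inclusion_surjective {k : ℕ} (hk : k ≠ n + 1) :
    Function.Surjective (intHomologyMap k (attachCellInclusion (n + 1) f)) := by
  cases k with
  | zero => exact map_inclusion_surjective_zero f
  | succ k =>
    obtain ⟨δ, h₁, h₂⟩ := exists_connecting f k
    intro x
    have := ((h₂ (δ x)).1 ⟨x, rfl⟩).2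
    rw [(isHomologySphere_diskBoundary n).1 k (by omega), AddSubgroup.mem_bot] at this
    exact (h₁ x).1 this

variable {e : IntHomology n (diskBoundary.{u} (n + 1))}

theorem map_inclusion_eq_zero_iff_mem_zmultiples
    (he : AddSubgroup.zmultiples e = reducedIntHomology n (diskBoundary.{u} (n + 1)))
    {x : IntHomology n X} :
    intHomologyMap n (attachCellInclusion (n + 1) f) x = 0 ↔
      x ∈ AddSubgroup.zmultiples (intHomologyMap n f e) := by
  rw [map_inclusion_eq_zero_iff, ← he, ← AddMonoidHom.map_zmultiples]
  rfl

theorem map_inclusion_surjective_of_infinite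
    (he : AddSubgroup.zmultiples e = reducedIntHomology n (diskBoundary.{u} (n + 1)))
    (h : Infinite (AddSubgroup.zmultiples (intHomologyMap n f e))) :
    Function.Surjective (intHomologyMap (n + 1) (attachCellInclusion (n + 1) f)) := by
  obtain ⟨δ, h₁, h₂⟩ := exists_connecting f n
  intro x
  obtain ⟨hf, hx⟩ := (h₂ (δ x)).1 ⟨x, rfl⟩
  rw [← he] at hx
  obtain ⟨m, hm⟩ := AddSubgroup.mem_zmultiples_iff.1 hx
  rw [← hm, map_zsmul, ← addOrderOf_dvd_iff_zsmul_eq_zero,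
    addOrderOf_eq_zero (infinite_zmultiples.1 (Set.infinite_coe_iff.1 h)),
    Nat.cast_zero, zero_dvd_iff] at hf
  exact (h₁ x).1 (by rw [← hm, hf, zero_smul])

/-- If `f_* e` has order `N > 0`, then the image of the boundary map of the cell is generated by
`N • e`, which has infinite order. -/
theorem exists_isShortExactSeq_of_finite
    (he : AddSubgroup.zmultiples e = reducedIntHomology n (diskBoundary.{u} (n + 1)))
    (h : Finite (AddSubgroup.zmultiples (intHomologyMap n f e))) :
    ∃ q : IntHomology (n + 1) (attachCell (n + 1) f) →+ ℤ,
      IsShortExactSeq (intHomologyMap (n + 1) (attachCellInclusion (n + 1) f)) q := by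
  obtain ⟨δ, h₁, h₂⟩ := exists_connecting f n
  set N := addOrderOf (intHomologyMap n f e) with hN
  have hN₀ : (N : ℤ) ≠ 0 :=
    Nat.cast_ne_zero.2 (addOrderOf_ne_zero_iff.2 (finite_zmultiples.1 (Set.toFinite _)))
  have hinj : ∀ m : ℤ, (m * N) • e = 0 → m = 0 := fun m hm =>
    (mul_eq_zero.1 ((isHomologySphere_diskBoundary n).eq_zero_of_zsmul he hm)).resolve_right hN₀
  have hδ : ∀ x, ∃ m : ℤ, δ x = (m * N) • e := fun x => by
    obtain ⟨hf, hx⟩ := (h₂ (δ x)).1 ⟨x, rfl⟩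
    rw [← he] at hx
    obtain ⟨m, hm⟩ := AddSubgroup.mem_zmultiples_iff.1 hx
    rw [← hm, map_zsmul, ← addOrderOf_dvd_iff_zsmul_eq_zero] at hf
    obtain ⟨l, rfl⟩ := hf
    exact ⟨l, by rw [← hm, mul_comm]⟩
  choose q hq using hδ
  have hq' : ∀ x (m : ℤ), δ x = (m * N) • e → q x = m := fun x m hm =>
    sub_eq_zero.1 (hinj _ (by rw [sub_mul, sub_smul, ← hq, ← hm, sub_self]))
  refine ⟨AddMonoidHom.mk' q fun x y => hq' _ _ (by
    rw [map_add, add_mul, add_smul, ← hq, ← hq]), map_inclusion_injective f n.succ_ne_self,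
    fun x => ?_, fun m => ?_⟩
  · refine Iff.trans ⟨fun hx => ?_, fun hx => ?_⟩ (h₁ x)
    · rw [hq x, show q x = 0 from hx, zero_mul, zero_smul]
    · exact hq' x 0 (by rw [hx, zero_mul, zero_smul])
  · obtain ⟨x, hx⟩ := (h₂ ((m * N) • e)).2 ⟨by
      rw [map_zsmul, mul_smul, natCast_zsmul, hN, addOrderOf_nsmul_eq_zero, smul_zero],
      he ▸ AddSubgroup.zsmul_mem_zmultiples e _⟩
    exact ⟨x, hq' x m hx⟩

end Succ

section Zero

variable {X : TopCat.{u}} (f : diskBoundary.{u} 0 ⟶ X)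

instance : IsEmpty (diskBoundary.{u} 0) :=
  ⟨fun y => zero_ne_one (norm_zero.symm.trans <| (congrArg norm (Subsingleton.elim _ _)).trans
    (mem_sphere_zero_iff_norm.1 y.down.2))⟩

instance : IsEmpty (PuncturedCell.{u} 0) := ⟨fun y => y.down.2.2 (Subsingleton.elim _ _)⟩

theorem map_inclusion_bijective_of_zero {k : ℕ} (hk : k ≠ 0) :
    Function.Bijective (intHomologyMap k (attachCellInclusion 0 f)) := by
  have := ((openCoverSquare f).map_left_bijective_of_isEmpty (isAcyclicSpace_openCell 0) hk).comp
    (bijective_puncturedBase f k)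
  rwa [show intHomologyMap k (attachCellInclusion 0 f) = (intHomologyMap k _).comp _ from
    AddMonoidHom.ext (map_inclusion f k), AddMonoidHom.coe_comp]

/-- Attaching a `0`-cell adds a disjoint point, hence a summand `ℤ` in degree `0`. -/
theorem exists_isShortExactSeq_of_zero :
    ∃ q : IntHomology 0 (attachCell 0 f) →+ ℤ,
      IsShortExactSeq (intHomologyMap 0 (attachCellInclusion 0 f)) q := by
  let Φ := AddEquiv.ofBijective _ (openCoverSquare f).coprod_bijective_of_isEmpty
  let p := pointHomologyEquiv.toAddMonoidHom.comp (intHomologyMap 0 (toPoint (OpenCell.{u} 0)))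
  have hp : Function.Bijective p :=
    pointHomologyEquiv.bijective.comp (isAcyclicSpace_openCell 0 0)
  have hΦ : ∀ u, Φ (u, 0) = intHomologyMap 0 (puncturedInclusion f) u := fun u => by
    change intHomologyMap 0 _ u + intHomologyMap 0 _ 0 = _
    rw [map_zero, add_zero]
  refine ⟨(p.comp (AddMonoidHom.snd _ _)).comp Φ.symm.toAddMonoidHom, ?_, fun x => ?_, ?_⟩
  · refine (injective_iff_map_eq_zero _).2 fun x hx => ?_
    rw [map_inclusion, ← hΦ, map_eq_zero_iff Φ Φ.injective] at hx
    exact (map_eq_zero_iff _ (bijective_puncturedBase f 0).1).1 (congrArg Prod.fst hx)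
  · refine (map_eq_zero_iff p hp.1).trans ⟨fun hx => ?_, ?_⟩
    · obtain ⟨y, hy⟩ := (bijective_puncturedBase f 0).2 (Φ.symm x).1
      refine ⟨y, ?_⟩
      rw [map_inclusion, hy, ← hΦ, ← Φ.apply_symm_apply x]
      exact congrArg Φ (Prod.ext (by simp) hx.symm)
    · rintro ⟨y, rfl⟩
      rw [map_inclusion, ← hΦ]
      exact congrArg Prod.snd (Φ.symm_apply_apply _)
  · exact (hp.2.comp Prod.snd_surjective).comp Φ.symm.surjective

end Zero

end AttachCell

end

/-! ### Homology of the adjunction space -/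

theorem theorem1 (r : ℕ) (X : TopCat.{u}) (f : diskBoundary.{u} r ⟶ X) :
    -- the inclusion induces isomorphisms in all degrees other than `r` and `r - 1`
    (∀ k : ℕ, k ≠ r → k + 1 ≠ r →
      Function.Bijective (intHomologyMap k (attachCellInclusion r f))) ∧
    -- the sphere has a fundamental class, and whichever one is taken:
    (∃ e : IntHomology (r - 1) (diskBoundary.{u} r), IsSphereFundamentalClass r e) ∧
    (∀ e : IntHomology (r - 1) (diskBoundary.{u} r), IsSphereFundamentalClass r e →
      -- `0 → a_f → H_{r-1}(X) → H_{r-1}(X_f) → 0`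
      -- (for `r = 0` both homology groups are in degree `-1` and there is nothing to say)
      (1 ≤ r → IsShortExactSeq (attachingSubgroup r f e).subtype
        (intHomologyMap (r - 1) (attachCellInclusion r f))) ∧
      -- `0 → H_r(X) → H_r(X_f) → 0` if `a_f` is infinite
      (Infinite (attachingSubgroup r f e) →
        Function.Bijective (intHomologyMap r (attachCellInclusion r f))) ∧
      -- `0 → H_r(X) → H_r(X_f) → ℤ → 0` if `a_f` is finite
      (Finite (attachingSubgroup r f e) →
        ∃ q : IntHomology r (attachCell r f) →+ ℤ,
          IsShortExactSeq (intHomologyMap r (attachCellInclusion r f)) q)) := by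
  cases r with
  | zero =>
    refine ⟨fun k hk _ => AttachCell.map_inclusion_bijective_of_zero f hk, ⟨0, ?_⟩, fun e _ =>
      ⟨fun h => absurd h (by norm_num), fun h => ?_,
        fun _ => AttachCell.exists_isShortExactSeq_of_zero f⟩⟩
    · refine SetLike.ext fun x => ?_
      rw [homology_eq_zero_of_isEmpty _ _ x]
      exact ⟨fun _ => zero_mem _, fun _ => zero_mem _⟩
    · -- The sphere is empty, so that `a_f` is trivial.
      rw [attachingSubgroup, homology_eq_zero_of_isEmpty _ _ e, map_zero,
        AddSubgroup.zmultiples_zero_eq_bot] at h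
      exact absurd h (not_infinite_iff_finite.2 inferInstance)
  | succ n =>
    refine ⟨fun k hk hk' => ⟨AttachCell.map_inclusion_injective f (by omega),
      AttachCell.map_inclusion_surjective f hk⟩, ?_, fun e he => ⟨fun _ => ?_, fun h => ?_,
      fun h => AttachCell.exists_isShortExactSeq_of_finite f he h⟩⟩
    · obtain ⟨-, e, he, -⟩ := isHomologySphere_diskBoundary.{u} n
      exact ⟨e, he⟩
    · refine ⟨Subtype.val_injective, fun x => ?_,
        AttachCell.map_inclusion_surjective f n.succ_ne_self.symm⟩
      exact (AttachCell.map_inclusion_eq_zero_iff_mem_zmultiples f he).trans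
        ⟨fun hx => ⟨⟨x, hx⟩, rfl⟩, fun ⟨y, hy⟩ => hy ▸ y.2⟩
    · exact ⟨AttachCell.map_inclusion_injective f n.succ_ne_self,
        AttachCell.map_inclusion_surjective_of_infinite f he h⟩
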